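/- **Theorem.** Let $X$ be a zero-dimensional compact metrizable space, i.e. a compact metrizable space having a base of closed-and-open sets. Call $X$ * a *topological fractal* if $X$ is Hausdorff and $X=\bigcup_{f\in\mathcal F}f(X)$ for a finite system $\mathcal F$ of continuous self-maps of $X$ such that for every open cover $\mathcal U$ of $X$ there is $n\in\mathbb N$ such that for any $f_1,\dots,f_n\in\mathcal F$ the set $f_1\circ\dots\circ f_n(X)$ is contained in some $U\in\mathcal U$; * a *Banach fractal* if $X$ is compact metrizable and $X=\bigcup_{f\in\mathcal F}f(X)$ for a finite system $\mathcal F$ of self-maps of $X$ all of which have Lipschitz constant $<1$ with respect to some (common) metric generating the topology of $X$; * a *Banach ultrafractal* if $X$ is compact and $X=\bigcup_{f\in\mathcal F}f(X)$ for a finite family $\mathcal F$ of continuous self-maps of $X$ such that the family $(f(X))_{f\in\mathcal F}$ is disjoint and for every $\varepsilon>0$ there is an ultrametric $d$ generating the topology of $X$ with $\operatorname{Lip}(\mathcal F)=\sup_{f\in\mathcal F}\sup_{x\ne y}\frac{d(f(x),f(y))}{d(x,y)}<\varepsilon$. For $A\subset X$ let $A^{(1)}$ be the set of non-isolated points of $A$;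 put $X^{(0)}=X$ and $X^{(\alpha)}=\bigcap_{\beta<\alpha}(X^{(\beta)})^{(1)}$ for ordinals $\alpha>0$. If $X$ is scattered (every non-empty subspace has an isolated point), then each $x\in X$ has a scattered height, the unique ordinal $\hbar(x)$ with $x\in X^{(\hbar(x))}\setminus X^{(\hbar(x)+1)}$, and $\hbar(X)=\sup\{\hbar(x):x\in X\}$ (with $\sup\emptyset=0$). If $X$ is not scattered, then $\hbar(X)=\infty$. The ordinal $0$ is not a limit ordinal. The following conditions are equivalent: 1. $X$ is a topological fractal; 2. $X$ is a Banach fractal; 3. $X$ is a Banach ultrafractal; 4. the scattered height $\hbar(X)$ is not a countable limit ordinal; 5. $\hbar(X)$ is either $\infty$ or a countable ordinal that is zero or a successor; 6. $X$ is uncountable, or $X$ is countable (possibly finite) and $\hbar(X)$ is zero or a successor ordinal. -/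

import Mathlib

open Set Topology TopologicalSpace CantorBendixson
open scoped NNReal Cardinal

/-! ### Fractals -/

/-- `F` covers `X` by images: `X = ⋃_{f ∈ F} f(X)`. -/
def CoversByImages {X : Type*} (F : Set (X → X)) : Prop :=
  ⋃ f ∈ F, range f = univ

/-- A system `F` of self-maps of `X` is topologically contracting: for every open cover `𝒰`
there is `n` such that `f₁ ∘ ⋯ ∘ fₙ (X)` lies in some member of `𝒰`, for all
`f₁, …, fₙ ∈ F`. -/
def IsTopologicallyContracting {X : Type*} [TopologicalSpace X] (F : Set (X → X)) : Prop :=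
  ∀ 𝒰 : Set (Set X), (∀ U ∈ 𝒰, IsOpen U) → ⋃₀ 𝒰 = univ →
    ∃ n : ℕ, ∀ l : List (X → X), l.length = n → (∀ f ∈ l, f ∈ F) →
      ∃ U ∈ 𝒰, range (l.foldr (fun f g => f ∘ g) id) ⊆ U

/-- A metric `m` on the set `X` generates the given topology of `X`. -/
def GeneratesTopology {X : Type*} [t : TopologicalSpace X] (m : MetricSpace X) : Prop :=
  m.toPseudoMetricSpace.toUniformSpace.toTopologicalSpace = t

/-- `f` is Lipschitz with constant `K` with respect to the metric `m`. -/
def IsLipschitzFor {X : Type*} (m : MetricSpace X) (K : ℝ≥0) (f : X → X) : Prop :=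
  ∀ x y : X, m.dist (f x) (f y) ≤ K * m.dist x y

/-- The metric `m` is an ultrametric. -/
def IsUltrametric {X : Type*} (m : MetricSpace X) : Prop :=
  ∀ x y z : X, m.dist x z ≤ max (m.dist x y) (m.dist y z)

/-- Topological fractals. -/
def IsTopologicalFractal (X : Type*) [TopologicalSpace X] : Prop :=
  T2Space X ∧ ∃ F : Set (X → X), F.Finite ∧ (∀ f ∈ F, Continuous f) ∧
    CoversByImages F ∧ IsTopologicallyContracting F

/-- Banach fractals: one metric serves all the maps of the system. -/
def IsBanachFractal (X : Type*) [TopologicalSpace X] : Prop :=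
  CompactSpace X ∧ MetrizableSpace X ∧ ∃ F : Set (X → X), F.Finite ∧ CoversByImages F ∧
    ∃ m : MetricSpace X, GeneratesTopology m ∧
      ∀ f ∈ F, ∃ K : ℝ≥0, K < 1 ∧ IsLipschitzFor m K f

/-- Banach ultrafractals: the system `F` is fixed first, and for every `ε > 0` there is an
ultrametric generating the topology for which `Lip(F) < ε`. -/
def IsBanachUltrafractal (X : Type*) [TopologicalSpace X] : Prop :=
  CompactSpace X ∧ ∃ F : Set (X → X), F.Finite ∧ (∀ f ∈ F, Continuous f) ∧
    CoversByImages F ∧ F.PairwiseDisjoint (fun f => range f) ∧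
    ∀ ε : ℝ, 0 < ε → ∃ m : MetricSpace X, GeneratesTopology m ∧ IsUltrametric m ∧
      ∃ K : ℝ≥0, (K : ℝ) < ε ∧ ∀ f ∈ F, IsLipschitzFor m K f

/-! ### Scattered height -/

/-- A space is scattered if every nonempty subspace has an isolated point. -/
def IsScatteredSpace (X : Type*) [TopologicalSpace X] : Prop :=
  ∀ A : Set X, A.Nonempty → ∃ x ∈ A, ∃ U : Set X, IsOpen U ∧ U ∩ A = {x}

/-- The scattered height of a point `x`: the unique ordinal `a` with `x ∈ X⁽ᵃ⁾ \ X⁽ᵃ⁺¹⁾`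
(and `0`, by convention, if `x` is in the perfect kernel, so that there is no such `a`). -/
noncomputable def pointHeight {X : Type*} [TopologicalSpace X] (x : X) : Ordinal :=
  sInf {a : Ordinal | x ∈ iteratedDerivedSet (univ : Set X) a \
    iteratedDerivedSet (univ : Set X) (a + 1)}

open Classical in
/-- The scattered height of `X`: the supremum of the heights of the points if `X` is scattered,
and `∞ = ⊤` otherwise. -/
noncomputable def scatteredHeight (X : Type*) [TopologicalSpace X] : WithTop Ordinal :=
  if IsScatteredSpace X then ((⨆ x : X, pointHeight x : Ordinal) : WithTop Ordinal) else ⊤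

/-- `o` is a countable limit ordinal; `0` does not count as a limit ordinal. -/
def IsCountableLimitOrdinal (o : WithTop Ordinal) : Prop :=
  ∃ a : Ordinal, o = a ∧ a.card ≤ ℵ₀ ∧ Order.IsSuccLimit a

/-- `o` is an ordinal (not `∞`) which is zero or a successor. -/
def IsZeroOrSuccessorOrdinal (o : WithTop Ordinal) : Prop :=
  ∃ a : Ordinal, o = a ∧ (a = 0 ∨ ∃ b : Ordinal, a = b + 1)

/-- `o` is a countable ordinal (not `∞`). -/
def IsCountableOrdinal (o : WithTop Ordinal) : Prop :=
  ∃ a : Ordinal, o = a ∧ a.card ≤ ℵ₀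

/-!
Every condition is tied to the existence of a *resolving system*: finitely many continuous
self-maps with disjoint ranges covering `X` such that every clopen set `B` is resolved in some
number `n` of steps, that is, the preimage of `B` under each composition of `n` of the maps is empty
or all of `X`. The conditions on the height and on the cardinality are equivalent by
Cantor–Bendixson theory: a scattered `X` is countable and of countable height, any other is
uncountable and of height `⊤`. So a resolving system has to be found unless the height is a limit
ordinal, and limit heights have to be excluded for topological fractals.

*Sufficiency.* Given a resolving system, call two points `n`-equivalent if no clopen set resolved in
`n` steps separates them. There are only finitely many such sets, each map of the system sends
`n`-equivalent points to `(n + 1)`-equivalent ones, and so `δ ^ n`, for the least `n` with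
non-equivalent points, is an ultrametric with Lipschitz constant at most `δ`, for every `δ < 1`
(`HasResolvingSystem.isBanachUltrafractal`). Resolving systems are found as follows.

* If `X` is not scattered, it contains a perfect set. A binary scheme of clopen sets meeting that
  set yields a continuous surjection from the Cantor set onto the set of each node, with the
  code `0` and `10` for the children and `11` for the residue of the node; read the other way, the
  scheme yields an address map from `X` to the Cantor set. The maps of the system send a point to
  its address and that back to `X` (`hasResolvingSystem_of_perfect`).
* If `X` is scattered and its height is a successor `a + 1`, then `X` is split into clopen pieces
  with one point of height `a + 1` each. Such a piece is the one-point compactification of a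
  sequence of pieces with one point of maximal height `a`, and these are split further, which
  describes the piece as the space of a well-founded tree. The space of a tree maps
  onto that of every tree of the same or smaller rank, preserving depth
  (`WfTree.exists_surjective_preservesDepth`). Hence a map that moves each child of the root to the
  next one, and a map that sends everything to the first child, form a resolving system
  (`WfTree.hasResolvingSystem_of_hasRank`). The other pieces are continuous images of one of them
  (`HasResolvingSystem.of_pieces`).
* If the height is `0`, the space is finite and the constant maps do.

*Necessity.* Continuous maps do not raise heights, so the derivatives of a topological fractal are
covered by their own images (`iteratedDerivedSet_subset_biUnion_image`). If the height were a limit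
ordinal, then the finitely many points of top height would be limits of points of large smaller
height, and such a pair could be pulled back along the system any number of times; so no
number of steps would separate its two points
(`IsTopologicalFractal.not_isCountableLimitOrdinal`).
-/

/-! ### Resolving systems of maps -/

/-- `B` is resolved by the system `f` in `n` steps: for every word `w` of length `n` in the maps
`f i`, the preimage of `B` under the composition `f_w` is empty or the whole space. -/
def ResolvedIn {ι X : Type*} (f : ι → X → X) : ℕ → Set X → Prop
  | 0, B => B = ∅ ∨ B = univ
  | n + 1, B => ∀ i, ResolvedIn f n (f i ⁻¹' B)

/-- `B` is resolved by the system `f` in some number of steps. -/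
def Resolved {ι X : Type*} (f : ι → X → X) (B : Set X) : Prop :=
  ∃ n, ResolvedIn f n B

section Resolved

variable {ι X : Type*} {f : ι → X → X}

lemma resolvedIn_empty (n : ℕ) : ResolvedIn f n ∅ := by
  induction n with
  | zero => exact Or.inl rfl
  | succ n ih => intro i; simpa using ih

lemma resolvedIn_univ (n : ℕ) : ResolvedIn f n univ := by
  induction n with
  | zero => exact Or.inr rfl
  | succ n ih => intro i; simpa using ih

lemma ResolvedIn.succ {n : ℕ} : ∀ {B : Set X}, ResolvedIn f n B → ResolvedIn f (n + 1) B := by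
  induction n with
  | zero =>
    rintro B (rfl | rfl)
    · exact resolvedIn_empty 1
    · exact resolvedIn_univ 1
  | succ n ih => exact fun h i => ih (h i)

lemma ResolvedIn.mono {n m : ℕ} (hnm : n ≤ m) {B : Set X} (h : ResolvedIn f n B) :
    ResolvedIn f m B := by
  induction hnm with
  | refl => exact h
  | step _ ih => exact ih.succ

lemma ResolvedIn.compl {n : ℕ} : ∀ {B : Set X}, ResolvedIn f n B → ResolvedIn f n Bᶜ := by
  induction n with
  | zero =>
    rintro B (rfl | rfl)
    · exact Or.inr (by simp)
    · exact Or.inl (by simp)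
  | succ n ih => exact fun h i => ih (h i)

lemma ResolvedIn.union {n : ℕ} :
    ∀ {B C : Set X}, ResolvedIn f n B → ResolvedIn f n C → ResolvedIn f n (B ∪ C) := by
  induction n with
  | zero =>
    rintro B C (rfl | rfl) (rfl | rfl)
    · exact Or.inl (by simp)
    · exact Or.inr (by simp)
    · exact Or.inr (by simp)
    · exact Or.inr (by simp)
  | succ n ih => exact fun h h' i => ih (h i) (h' i)

lemma resolved_empty : Resolved f ∅ := ⟨0, resolvedIn_empty 0⟩

lemma resolved_univ : Resolved f univ := ⟨0, resolvedIn_univ 0⟩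

lemma Resolved.compl {B : Set X} : Resolved f B → Resolved f Bᶜ :=
  fun ⟨n, h⟩ => ⟨n, h.compl⟩

lemma Resolved.union {B C : Set X} : Resolved f B → Resolved f C → Resolved f (B ∪ C) :=
  fun ⟨n, h⟩ ⟨m, h'⟩ =>
    ⟨max n m, (h.mono (le_max_left n m)).union (h'.mono (le_max_right n m))⟩

lemma Resolved.diff {B C : Set X} (h : Resolved f B) (h' : Resolved f C) :
    Resolved f (B \ C) := by
  have : B \ C = (Bᶜ ∪ C)ᶜ := by ext; simp
  rw [this]
  exact (h.compl.union h').compl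

lemma Resolved.biUnion {κ : Type*} {s : Set κ} (hs : s.Finite) {B : κ → Set X}
    (h : ∀ k ∈ s, Resolved f (B k)) : Resolved f (⋃ k ∈ s, B k) := by
  induction s, hs using Set.Finite.induction_on with
  | empty => simpa using resolved_empty
  | insert _ _ ih =>
    rw [biUnion_insert]
    exact (h _ (mem_insert _ _)).union (ih fun k hk => h k (mem_insert_of_mem _ hk))

lemma Resolved.of_preimage [Finite ι] {B : Set X} (h : ∀ i, Resolved f (f i ⁻¹' B)) :
    Resolved f B := by
  cases nonempty_fintype ι
  choose n hn using h
  exact ⟨Finset.univ.sup n + 1, fun i => (hn i).mono (Finset.le_sup (Finset.mem_univ i))⟩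

/-- A covering finite system resolves only finitely many sets in `n` steps, because a set is
recovered from its preimages under the maps of the system. -/
lemma finite_setOf_resolvedIn [Finite ι] (hcov : ⋃ i, range (f i) = univ) (n : ℕ) :
    {B : Set X | ResolvedIn f n B}.Finite := by
  induction n with
  | zero => exact (toFinite {∅, univ}).subset fun B hB => hB
  | succ n ih =>
    have hinj : Function.Injective fun (B : Set X) (i : ι) => f i ⁻¹' B := by
      intro B C h
      ext x
      obtain ⟨i, y, rfl⟩ := mem_iUnion.1 (hcov.symm ▸ mem_univ x)
      exact iff_of_eq (congrArg (y ∈ ·) (congrFun h i))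
    refine Set.Finite.of_injOn (f := fun (B : Set X) (i : ι) => f i ⁻¹' B)
      (t := univ.pi fun _ => {B : Set X | ResolvedIn f n B}) ?_ hinj.injOn
      (Set.Finite.pi fun _ => ih)
    intro B hB i _
    exact hB i

end Resolved

/-- A resolving system on `X`: finitely many continuous self-maps with pairwise disjoint ranges
covering `X`, which resolve every clopen set. For zero-dimensional compact `X` the last condition
says that the system is topologically contracting. -/
def HasResolvingSystem (X : Type*) [TopologicalSpace X] : Prop :=
  ∃ (ι : Type) (_ : Finite ι) (f : ι → X → X), (∀ i, Continuous (f i)) ∧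
    (Pairwise fun i j => Disjoint (range (f i)) (range (f j))) ∧
    (⋃ i, range (f i) = univ) ∧ ∀ B : Set X, IsClopen B → Resolved f B

/-- Transfer of a resolving system from `M` to a space `X` that is partitioned into images
`u j (M)`, one of which, `u j₀ (M)`, is a copy of `M` onto which `X` retracts by `g` in such a way
that all other pieces are collapsed to points. -/
lemma HasResolvingSystem.of_pieces {X M : Type*} [TopologicalSpace X] [TopologicalSpace M]
    (hM : HasResolvingSystem M) {κ : Type} [Finite κ] (u : κ → M → X)
    (hu : ∀ j, Continuous (u j))
    (hdisj : Pairwise fun i j => Disjoint (range (u i)) (range (u j)))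
    (hcov : ⋃ j, range (u j) = univ) (g : X → M) (hg : Continuous g) (j₀ : κ)
    (hgu : ∀ y, g (u j₀ y) = y) (hconst : ∀ j, j ≠ j₀ → ∃ a, ∀ y, g (u j y) = a) :
    HasResolvingSystem X := by
  obtain ⟨ι, _, f, hf, hfd, hfc, hfr⟩ := hM
  have hgs : Function.Surjective g := fun y => ⟨_, hgu y⟩
  have huinj : Function.Injective (u j₀) := fun y z h => by rw [← hgu y, h, hgu]
  let F : ι ⊕ {j : κ // j ≠ j₀} → X → X :=
    Sum.elim (fun i => u j₀ ∘ f i ∘ g) (fun j => u j ∘ g)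
  have hrl : ∀ i, range (F (.inl i)) = u j₀ '' range (f i) := fun i => by
    simp only [F, Sum.elim_inl]
    rw [range_comp, range_comp, hgs.range_eq, image_univ]
  have hrr : ∀ j, range (F (.inr j)) = range (u j) := fun j => by
    simp only [F, Sum.elim_inr]
    rw [range_comp, hgs.range_eq, image_univ]
  have hFc : ∀ i, Continuous (F i) := by
    rintro (i | j)
    · exact (hu _).comp ((hf i).comp hg)
    · exact (hu _).comp hg
  have key : ∀ n W, ResolvedIn f n W → ResolvedIn F n (g ⁻¹' W) := by
    intro n
    induction n with
    | zero =>
      rintro W (rfl | rfl)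
      · exact Or.inl rfl
      · exact Or.inr rfl
    | succ n ih =>
      rintro W hW (i | j)
      · have : F (.inl i) ⁻¹' (g ⁻¹' W) = g ⁻¹' (f i ⁻¹' W) := by
          ext x; simp [F, hgu]
        rw [this]
        exact ih _ (hW i)
      · obtain ⟨a, ha⟩ := hconst j j.2
        by_cases haW : a ∈ W
        · have : F (.inr j) ⁻¹' (g ⁻¹' W) = univ := by ext x; simp [F, ha, haW]
          rw [this]; exact resolvedIn_univ n
        · have : F (.inr j) ⁻¹' (g ⁻¹' W) = ∅ := by ext x; simp [F, ha, haW]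
          rw [this]; exact resolvedIn_empty n
  refine ⟨_, inferInstance, F, hFc, ?_, ?_, ?_⟩
  · rintro (i | i) (j | j) hij
    · rw [hrl, hrl]
      exact (disjoint_image_iff huinj).2 (hfd fun h => hij (h ▸ rfl))
    · rw [hrl, hrr]
      exact (hdisj j.2.symm).mono_left (image_subset_range _ _)
    · rw [hrr, hrl]
      exact (hdisj i.2).mono_right (image_subset_range _ _)
    · rw [hrr, hrr]
      exact hdisj fun h => hij (by rw [Subtype.ext h])
  · rw [eq_univ_iff_forall]
    intro x
    obtain ⟨j, y, rfl⟩ := mem_iUnion.1 (hcov.symm ▸ mem_univ x)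
    by_cases hj : j = j₀
    · subst hj
      obtain ⟨i, z, rfl⟩ := mem_iUnion.1 (hfc.symm ▸ mem_univ y)
      exact mem_iUnion.2 ⟨.inl i, by rw [hrl]; exact mem_image_of_mem _ (mem_range_self z)⟩
    · exact mem_iUnion.2 ⟨.inr ⟨j, hj⟩, by rw [hrr]; exact mem_range_self y⟩
  · intro V hV
    refine Resolved.of_preimage ?_
    rintro (i | j)
    · obtain ⟨n, hn⟩ := hfr _ (hV.preimage ((hu j₀).comp (hf i)))
      exact ⟨n, key n _ hn⟩
    · obtain ⟨n, hn⟩ := hfr _ (hV.preimage (hu j))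
      exact ⟨n, key n _ hn⟩

/-! ### Resolving systems are Banach ultrafractals -/

section Ultrametric

variable {X : Type*} [TopologicalSpace X]

/-- Points are `n`-equivalent for the system `f` if no clopen set that is resolved in `n` steps
separates them. -/
def StepEquiv {ι : Type*} (f : ι → X → X) (n : ℕ) (x y : X) : Prop :=
  ∀ B : Set X, IsClopen B → ResolvedIn f n B → (x ∈ B ↔ y ∈ B)

variable {ι : Type*} {f : ι → X → X}

lemma StepEquiv.symm {n : ℕ} {x y : X} (h : StepEquiv f n x y) : StepEquiv f n y x :=
  fun B hB hn => (h B hB hn).symm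

lemma StepEquiv.trans {n : ℕ} {x y z : X} (h : StepEquiv f n x y) (h' : StepEquiv f n y z) :
    StepEquiv f n x z :=
  fun B hB hn => (h B hB hn).trans (h' B hB hn)

lemma stepEquiv_refl (n : ℕ) (x : X) : StepEquiv f n x x := fun _ _ _ => Iff.rfl

lemma stepEquiv_zero (x y : X) : StepEquiv f 0 x y := by
  rintro B - (rfl | rfl) <;> simp

lemma StepEquiv.mono {n m : ℕ} (hnm : n ≤ m) {x y : X} (h : StepEquiv f m x y) :
    StepEquiv f n x y :=
  fun B hB hn => h B hB (hn.mono hnm)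

lemma StepEquiv.map {n : ℕ} {x y : X} (h : StepEquiv f n x y) (hf : ∀ i, Continuous (f i))
    (i : ι) : StepEquiv f (n + 1) (f i x) (f i y) :=
  fun B hB hn => h (f i ⁻¹' B) (hB.preimage (hf i)) (hn i)

lemma isOpen_setOf_stepEquiv [Finite ι] (hcov : ⋃ i, range (f i) = univ) (n : ℕ) (x : X) :
    IsOpen {y | StepEquiv f n x y} := by
  have hfin : {B : Set X | IsClopen B ∧ ResolvedIn f n B}.Finite :=
    (finite_setOf_resolvedIn hcov n).subset fun B hB => hB.2
  have : {y | StepEquiv f n x y} =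
      ⋂ B ∈ {B : Set X | IsClopen B ∧ ResolvedIn f n B}, {y | x ∈ B ↔ y ∈ B} := by
    ext y; simp [StepEquiv, and_imp]
  rw [this]
  refine hfin.isOpen_biInter fun B hB => ?_
  by_cases hx : x ∈ B
  · simpa [hx] using hB.1.isOpen
  · have : {y | x ∈ B ↔ y ∈ B} = Bᶜ := by ext; simp [hx]
    rw [this]
    exact hB.1.compl.isOpen

open Classical in
/-- The distance `δ ^ n` for the least `n` such that the points are not `n`-equivalent (and `0`
if there is none). -/
noncomputable def stepDist (f : ι → X → X) (δ : ℝ) (x y : X) : ℝ :=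
  if h : ∃ n, ¬ StepEquiv f n x y then δ ^ Nat.find h else 0

variable {δ : ℝ}

lemma pow_le_stepDist (h0 : 0 < δ) (h1 : δ < 1) {n : ℕ} {x y : X}
    (h : ¬ StepEquiv f n x y) : δ ^ n ≤ stepDist f δ x y := by
  classical
  have hex : ∃ n, ¬ StepEquiv f n x y := ⟨n, h⟩
  rw [stepDist, dif_pos hex]
  exact pow_le_pow_of_le_one h0.le h1.le (Nat.find_min' hex h)

lemma stepDist_eq_zero_or (x y : X) :
    (stepDist f δ x y = 0 ∧ ∀ n, StepEquiv f n x y) ∨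
      ∃ n, ¬ StepEquiv f n x y ∧ stepDist f δ x y = δ ^ n := by
  classical
  by_cases hex : ∃ n, ¬ StepEquiv f n x y
  · exact Or.inr ⟨Nat.find hex, Nat.find_spec hex, dif_pos hex⟩
  · exact Or.inl ⟨dif_neg hex, by simpa using hex⟩

lemma stepDist_nonneg (h0 : 0 < δ) (x y : X) : 0 ≤ stepDist f δ x y := by
  rcases stepDist_eq_zero_or (f := f) (δ := δ) x y with ⟨h, -⟩ | ⟨n, -, h⟩ <;> rw [h]
  positivity

lemma stepDist_self (x : X) : stepDist f δ x x = 0 := by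
  simp [stepDist, stepEquiv_refl]

lemma stepDist_le_max (h0 : 0 < δ) (h1 : δ < 1) (x y z : X) :
    stepDist f δ x z ≤ max (stepDist f δ x y) (stepDist f δ y z) := by
  rcases stepDist_eq_zero_or (f := f) (δ := δ) x z with ⟨h, -⟩ | ⟨n, hn, h⟩
  · rw [h]
    exact le_max_of_le_left (stepDist_nonneg h0 x y)
  · rw [h, le_max_iff]
    by_cases hxy : StepEquiv f n x y
    · exact Or.inr (pow_le_stepDist h0 h1 fun hyz => hn (hxy.trans hyz))
    · exact Or.inl (pow_le_stepDist h0 h1 hxy)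

lemma stepDist_comm (h0 : 0 < δ) (h1 : δ < 1) (x y : X) :
    stepDist f δ x y = stepDist f δ y x := by
  have key : ∀ x y : X, stepDist f δ x y ≤ stepDist f δ y x := fun x y => by
    rcases stepDist_eq_zero_or (f := f) (δ := δ) x y with ⟨h, -⟩ | ⟨n, hn, h⟩
    · rw [h]
      exact stepDist_nonneg h0 y x
    · rw [h]
      exact pow_le_stepDist h0 h1 fun h' => hn h'.symm
  exact le_antisymm (key x y) (key y x)

lemma stepDist_map_le (h0 : 0 < δ) (h1 : δ < 1) (hf : ∀ i, Continuous (f i)) (i : ι) (x y : X) :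
    stepDist f δ (f i x) (f i y) ≤ δ * stepDist f δ x y := by
  rcases stepDist_eq_zero_or (f := f) (δ := δ) (f i x) (f i y) with ⟨h, -⟩ | ⟨n, hn, h⟩
  · rw [h]
    exact mul_nonneg h0.le (stepDist_nonneg h0 x y)
  · rcases n with _ | n
    · exact absurd (stepEquiv_zero _ _) hn
    · rw [h, pow_succ']
      exact mul_le_mul_of_nonneg_left (pow_le_stepDist h0 h1 fun h' => hn (h'.map hf i)) h0.le

lemma isOpen_iff_stepDist [Finite ι] (h0 : 0 < δ) (h1 : δ < 1)
    (hzero : IsTopologicalBasis {s : Set X | IsClopen s}) (hcov : ⋃ i, range (f i) = univ)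
    (hres : ∀ B : Set X, IsClopen B → Resolved f B) (s : Set X) :
    IsOpen s ↔ ∀ x ∈ s, ∃ ε > 0, ∀ y, stepDist f δ x y < ε → y ∈ s := by
  constructor
  · intro hs x hx
    obtain ⟨B, hB, hxB, hBs⟩ := hzero.exists_subset_of_mem_open hx hs
    obtain ⟨n, hn⟩ := hres B hB
    refine ⟨δ ^ n, by positivity, fun y hy => hBs ?_⟩
    by_contra hyB
    exact absurd (pow_le_stepDist h0 h1 fun h => hyB ((h B hB hn).1 hxB)) (not_le.2 hy)
  · intro h
    rw [isOpen_iff_mem_nhds]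
    intro x hx
    obtain ⟨ε, hε, hεs⟩ := h x hx
    obtain ⟨n, hn⟩ := exists_pow_lt_of_lt_one hε h1
    filter_upwards [(isOpen_setOf_stepEquiv hcov n x).mem_nhds (stepEquiv_refl n x)] with y hy
    refine hεs y (lt_of_le_of_lt ?_ hn)
    rcases stepDist_eq_zero_or (f := f) (δ := δ) x y with ⟨h, -⟩ | ⟨m, hm, h⟩
    · rw [h]
      positivity
    · rw [h]
      refine pow_le_pow_of_le_one h0.le h1.le ?_
      by_contra hlt
      exact hm (StepEquiv.mono (not_le.1 hlt).le hy)

end Ultrametric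

lemma HasResolvingSystem.isBanachUltrafractal {X : Type*} [TopologicalSpace X] [CompactSpace X]
    [T2Space X] (hzero : IsTopologicalBasis {s : Set X | IsClopen s})
    (h : HasResolvingSystem X) : IsBanachUltrafractal X := by
  obtain ⟨ι, _, f, hf, hfd, hfc, hfr⟩ := h
  refine ⟨inferInstance, range f, finite_range f, ?_, ?_, ?_, ?_⟩
  · rintro _ ⟨i, rfl⟩
    exact hf i
  · rw [CoversByImages, biUnion_range, hfc]
  · rintro _ ⟨i, rfl⟩ _ ⟨j, rfl⟩ hij
    exact hfd fun h => hij (h ▸ rfl)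
  · intro ε hε
    obtain ⟨δ, h0, hδ⟩ := exists_between (lt_min hε one_pos)
    obtain ⟨hδε, h1⟩ := lt_min_iff.1 hδ
    let m : MetricSpace X := MetricSpace.ofDistTopology (stepDist f δ) stepDist_self
      (stepDist_comm h0 h1)
      (fun x y z => (stepDist_le_max h0 h1 x y z).trans
        (max_le_add_of_nonneg (stepDist_nonneg h0 x y) (stepDist_nonneg h0 y z)))
      (isOpen_iff_stepDist h0 h1 hzero hfc hfr)
      (fun x y hxy => by
        by_contra hne
        obtain ⟨B, hB, hxB, hBy⟩ := hzero.exists_subset_of_mem_open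
          (show x ∈ ({y}ᶜ : Set X) from hne) isOpen_compl_singleton
        obtain ⟨n, hn⟩ := hfr B hB
        have := pow_le_stepDist (f := f) h0 h1 (n := n) (x := x) (y := y)
          fun h => hBy ((h B hB hn).1 hxB) rfl
        rw [hxy] at this
        exact absurd (pow_pos h0 n) (not_lt.2 this))
    refine ⟨m, rfl, stepDist_le_max h0 h1, ⟨δ, h0.le⟩, hδε, ?_⟩
    rintro _ ⟨i, rfl⟩ x y
    exact stepDist_map_le h0 h1 hf i x y

/-! ### Cantor–Bendixson derivatives of compact spaces -/

section Derivatives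

variable {X : Type*} [TopologicalSpace X]

lemma mem_iteratedDerivedSet_succ {s : Set X} {a : Ordinal} {x : X} :
    x ∈ sᵈ[a + 1] ↔ AccPt x (Filter.principal sᵈ[a]) ∧ x ∈ sᵈ[a] := by
  rw [iteratedDerivedSet_succ]
  rfl

lemma isClosed_iteratedDerivedSet_univ (a : Ordinal) : IsClosed (univ : Set X)ᵈ[a] :=
  isClosed_iteratedDerivedSet isClosed_univ a

/-- A compact set that misses the derivative of limit order misses an earlier one. -/
lemma exists_inter_iteratedDerivedSet_eq_empty {K : Set X} (hK : IsCompact K) {a : Ordinal}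
    (ha : Order.IsSuccLimit a) (h : K ∩ (univ : Set X)ᵈ[a] = ∅) :
    ∃ b < a, K ∩ (univ : Set X)ᵈ[b] = ∅ := by
  rw [iteratedDerivedSet_limit ha] at h
  have : Nonempty (Iio a) := ⟨⟨0, bot_lt_iff_ne_bot.2 ha.ne_bot⟩⟩
  obtain ⟨⟨b, hb⟩, hbK⟩ := hK.elim_directed_family_closed
    (fun b : Iio a => (univ : Set X)ᵈ[b]) (fun b => isClosed_iteratedDerivedSet_univ _) h
    (directed_of_isDirected_le fun b c hbc => iteratedDerivedSet_antitone _ hbc)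
  exact ⟨b, hb, hbK⟩

lemma IsScatteredSpace.not_perfect (hX : IsScatteredSpace X) {C : Set X} (hC : Perfect C) :
    ¬ C.Nonempty := by
  intro hne
  obtain ⟨x, hx, U, hU, hUC⟩ := hX C hne
  have hxU : x ∈ U := (hUC.symm ▸ mem_singleton x : x ∈ U ∩ C).1
  obtain ⟨y, hy, hyx⟩ := preperfect_iff_nhds.1 hC.acc x hx U (hU.mem_nhds hxU)
  exact hyx (hUC ▸ hy : y ∈ ({x} : Set X))

lemma IsScatteredSpace.exists_iteratedDerivedSet_eq_empty (hX : IsScatteredSpace X) :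
    ∃ a : Ordinal, (univ : Set X)ᵈ[a] = ∅ := by
  obtain ⟨a, ha⟩ := iteratedDerivedSet_mem_fixedPoints (univ : Set X)
  refine ⟨a, not_nonempty_iff_eq_empty.1 ?_⟩
  rw [← perfectKernel_eq_iteratedDerivedSet_of_mem_fixedPoints ha]
  exact hX.not_perfect (perfect_perfectKernel isClosed_univ)

lemma IsScatteredSpace.iteratedDerivedSet_succ_ne (hX : IsScatteredSpace X) {a : Ordinal}
    (h : ((univ : Set X)ᵈ[a]).Nonempty) : (univ : Set X)ᵈ[a + 1] ≠ (univ : Set X)ᵈ[a] := by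
  intro heq
  have := perfectKernel_eq_iteratedDerivedSet_of_mem_fixedPoints
    (mem_fixedPoints_of_iteratedDerivedSet_succ_eq heq)
  rw [← this] at h
  exact hX.not_perfect (perfect_perfectKernel isClosed_univ) h

/-- A nonempty compact piece of a scattered space has a last nonempty derivative, and that
derivative is finite. -/
lemma IsScatteredSpace.exists_finite_top [T2Space X] (hX : IsScatteredSpace X) {A : Set X}
    (hA : IsCompact A) (hne : A.Nonempty) :
    ∃ a : Ordinal, (A ∩ (univ : Set X)ᵈ[a]).Nonempty ∧ (A ∩ (univ : Set X)ᵈ[a]).Finite ∧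
      A ∩ (univ : Set X)ᵈ[a + 1] = ∅ := by
  classical
  have hex : ∃ a : Ordinal, A ∩ (univ : Set X)ᵈ[a] = ∅ := by
    obtain ⟨a, ha⟩ := hX.exists_iteratedDerivedSet_eq_empty
    exact ⟨a, by simp [ha]⟩
  obtain ⟨b, hb, hmin⟩ := WellFounded.has_min (wellFounded_lt (α := Ordinal))
    {a : Ordinal | A ∩ (univ : Set X)ᵈ[a] = ∅} hex
  rcases Ordinal.zero_or_succ_or_isSuccLimit b with rfl | ⟨a, rfl⟩ | hlim
  · simp only [mem_ofPred_eq, iteratedDerivedSet_zero, inter_univ] at hb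
    exact absurd hb hne.ne_empty
  · have hb' : A ∩ (univ : Set X)ᵈ[a + 1] = ∅ := hb
    refine ⟨a, ?_, ?_, hb'⟩
    · by_contra h
      exact hmin a (not_nonempty_iff_eq_empty.1 h) (by simp)
    · by_contra hinf
      obtain ⟨x, hxA, hx⟩ := Set.Infinite.exists_accPt_of_subset_isCompact hinf hA
        inter_subset_left
      have hx' : AccPt x (Filter.principal (univ : Set X)ᵈ[a]) :=
        hx.mono (Filter.principal_mono.2 inter_subset_right)
      have hxa : x ∈ (univ : Set X)ᵈ[a] :=
        (isClosed_iff_derivedSet_subset _).1 (isClosed_iteratedDerivedSet_univ a) hx'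
      exact (hb' ▸ ⟨hxA, mem_iteratedDerivedSet_succ.2 ⟨hx', hxa⟩⟩ : x ∈ (∅ : Set X))
  · obtain ⟨c, hc, hcA⟩ := exists_inter_iteratedDerivedSet_eq_empty hA hlim hb
    exact absurd hc (hmin c hcA)

lemma pointHeight_eq {x : X} {a : Ordinal} (hx : x ∈ (univ : Set X)ᵈ[a])
    (hx' : x ∉ (univ : Set X)ᵈ[a + 1]) : pointHeight x = a := by
  refine le_antisymm (csInf_le' ⟨hx, hx'⟩) ?_
  by_contra hlt
  push Not at hlt
  have hmem : pointHeight x ∈ {a : Ordinal | x ∈ (univ : Set X)ᵈ[a] \ (univ : Set X)ᵈ[a + 1]} :=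
    csInf_mem ⟨a, hx, hx'⟩
  exact hmem.2 (iteratedDerivedSet_antitone _ (Order.add_one_le_of_lt hlt) hx)

/-- The scattered height of a nonempty compact scattered space is the order of its last nonempty
derivative. -/
lemma IsScatteredSpace.exists_scatteredHeight_eq [CompactSpace X] [T2Space X] [Nonempty X]
    (hX : IsScatteredSpace X) :
    ∃ a : Ordinal, scatteredHeight X = a ∧ ((univ : Set X)ᵈ[a]).Nonempty ∧
      ((univ : Set X)ᵈ[a]).Finite ∧ (univ : Set X)ᵈ[a + 1] = ∅ := by
  obtain ⟨a, hne, hfin, hemp⟩ := hX.exists_finite_top isCompact_univ univ_nonempty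
  rw [univ_inter] at hne hfin hemp
  refine ⟨a, ?_, hne, hfin, hemp⟩
  rw [scatteredHeight, if_pos hX]
  congr 1
  have hle : ∀ x : X, pointHeight x ≤ a := fun x => by
    obtain ⟨b, hb, hmin⟩ := WellFounded.has_min (wellFounded_lt (α := Ordinal))
      {b : Ordinal | x ∉ (univ : Set X)ᵈ[b]} ⟨a + 1, by simp [hemp]⟩
    have hba : b ≤ a + 1 := by
      by_contra h
      exact hmin (a + 1) (by simp [hemp]) (not_le.1 h)
    rcases Ordinal.zero_or_succ_or_isSuccLimit b with rfl | ⟨c, rfl⟩ | hlim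
    · simp at hb
    · have hc : x ∈ (univ : Set X)ᵈ[c] := by
        by_contra h
        exact hmin c h (by simp)
      rw [pointHeight_eq hc hb]
      simpa using hba
    · refine absurd ?_ hb
      rw [iteratedDerivedSet_limit hlim, mem_iInter]
      rintro ⟨c, hc⟩
      by_contra h
      exact hmin c h hc
  refine le_antisymm (ciSup_le hle) ?_
  obtain ⟨x, hx⟩ := hne
  rw [← pointHeight_eq hx (by simp [hemp])]
  exact le_ciSup (f := fun x : X => (pointHeight x : Ordinal))
    ⟨a, by rintro _ ⟨y, rfl⟩; exact hle y⟩ x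

end Derivatives

lemma IsScatteredSpace.countable {X : Type*} [TopologicalSpace X] [SecondCountableTopology X]
    (hX : IsScatteredSpace X) : Countable X := by
  by_contra h
  obtain ⟨D, hD, hne, -⟩ := exists_perfect_nonempty_of_isClosed_of_not_countable
    (isClosed_univ (X := X)) (by rwa [countable_univ_iff])
  exact hX.not_perfect hD hne

lemma exists_perfect_of_not_isScatteredSpace {X : Type*} [TopologicalSpace X] [T1Space X]
    (hX : ¬ IsScatteredSpace X) : ∃ C : Set X, Perfect C ∧ C.Nonempty := by
  unfold IsScatteredSpace at hX
  push Not at hX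
  obtain ⟨A, hne, hA⟩ := hX
  refine ⟨closure A, Preperfect.perfect_closure ?_, hne.closure⟩
  rw [preperfect_iff_nhds]
  intro x hx U hU
  obtain ⟨V, hVU, hV, hxV⟩ := mem_nhds_iff.1 hU
  by_contra! h
  refine hA x hx V hV (Subset.antisymm (fun y hy => ?_) (by simp [hx, hxV]))
  exact h y ⟨hVU hy.1, hy.2⟩

lemma uncountable_of_not_isScatteredSpace {X : Type*} [TopologicalSpace X] [CompactSpace X]
    [MetrizableSpace X] (hX : ¬ IsScatteredSpace X) : Uncountable X := by
  let _ := metrizableSpaceMetric X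
  obtain ⟨C, hC, hne⟩ := exists_perfect_of_not_isScatteredSpace hX
  obtain ⟨f, -, -, hf⟩ := hC.exists_nat_bool_injection hne
  have : Uncountable (ℕ → Bool) := by
    rw [← Cardinal.aleph0_lt_mk_iff]
    simpa using Cardinal.cantor ℵ₀
  exact hf.uncountable

/-- The derivatives of a countable scattered space strictly decrease until they vanish, so the
order of a nonempty derivative is countable. -/
lemma IsScatteredSpace.card_le_aleph0 {X : Type*} [TopologicalSpace X] [Countable X]
    (hX : IsScatteredSpace X) {a : Ordinal} (ha : ((univ : Set X)ᵈ[a]).Nonempty) :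
    a.card ≤ ℵ₀ := by
  have hex : ∀ b : Iio a, ∃ x : X, x ∈ (univ : Set X)ᵈ[b] ∧ x ∉ (univ : Set X)ᵈ[b + 1] := by
    rintro ⟨b, hb⟩
    by_contra! h
    refine hX.iteratedDerivedSet_succ_ne (ha.mono (iteratedDerivedSet_antitone _ (le_of_lt hb)))
      (Subset.antisymm (iteratedDerivedSet_antitone _ (by simp)) h)
  choose x hx hx' using hex
  have hinj : Function.Injective x := by
    intro b c hbc
    have hb := pointHeight_eq (hx b) (hx' b)
    rw [hbc, pointHeight_eq (hx c) (hx' c)] at hb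
    exact Subtype.ext hb.symm
  have : Countable (Iio a) := hinj.countable
  have hle : Cardinal.mk (Iio a) ≤ ℵ₀ := Cardinal.mk_le_aleph0
  rw [Cardinal.mk_Iio_ordinal, Cardinal.lift_le_aleph0] at hle
  exact hle

/-! ### Banach ultrafractals, Banach fractals and topological fractals -/

lemma IsBanachUltrafractal.isBanachFractal {X : Type*} [TopologicalSpace X] [MetrizableSpace X]
    (h : IsBanachUltrafractal X) : IsBanachFractal X := by
  obtain ⟨hc, F, hF, -, hcov, -, hε⟩ := h
  obtain ⟨m, hm, -, K, hK, hlip⟩ := hε 1 one_pos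
  exact ⟨hc, inferInstance, F, hF, hcov, m, hm, fun f hf => ⟨K, by exact_mod_cast hK, hlip f hf⟩⟩

lemma IsLipschitzFor.lipschitzWith {X : Type*} {m : MetricSpace X} {K : ℝ≥0} {f : X → X}
    (h : IsLipschitzFor m K f) : LipschitzWith K f :=
  LipschitzWith.of_dist_le_mul h

lemma IsBanachFractal.isTopologicalFractal {X : Type*} [TopologicalSpace X]
    (h : IsBanachFractal X) : IsTopologicalFractal X := by
  obtain ⟨hc, hmet, F, hF, hcov, m, hm, hlip⟩ := h
  refine ⟨inferInstance, ?_⟩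
  rcases isEmpty_or_nonempty X with hX | hX
  · -- On the empty space the empty system is needed: the empty cover has no member.
    refine ⟨∅, finite_empty, by simp, by simp [CoversByImages, univ_eq_empty_iff.2 hX], ?_⟩
    rintro 𝒰 - -
    refine ⟨1, fun l hl hlF => ?_⟩
    obtain ⟨f, rfl⟩ := List.length_eq_one_iff.1 hl
    exact absurd (hlF f (by simp)) (notMem_empty f)
  unfold GeneratesTopology at hm
  subst hm
  choose! K hK1 hKlip using hlip
  obtain ⟨q, hq, hqF⟩ : ∃ q : ℝ≥0, q < 1 ∧ ∀ f ∈ F, K f ≤ q := by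
    refine ⟨hF.toFinset.sup K, ?_, fun f hf => Finset.le_sup (hF.mem_toFinset.2 hf)⟩
    rw [Finset.sup_lt_iff (by simp)]
    exact fun f hf => hK1 f (hF.mem_toFinset.1 hf)
  refine ⟨F, hF, fun f hf => (hKlip f hf).lipschitzWith.continuous, hcov, ?_⟩
  intro 𝒰 hopen hcover
  obtain ⟨δ, hδ, hLeb⟩ := lebesgue_number_lemma_of_metric_sUnion (isCompact_univ (X := X)) hopen
    hcover.symm.subset
  have hcomp : ∀ l : List (X → X), (∀ f ∈ l, f ∈ F) →
      LipschitzWith (q ^ l.length) (l.foldr (fun f g => f ∘ g) id) := by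
    intro l
    induction l with
    | nil => intro _; simpa using LipschitzWith.id
    | cons f l ih =>
      intro hl
      rw [List.foldr_cons, List.length_cons, pow_succ']
      exact ((hKlip f (hl f (by simp))).lipschitzWith.weaken (hqF f (hl f (by simp)))).comp
        (ih fun g hg => hl g (by simp [hg]))
  obtain ⟨n, hn⟩ : ∃ n : ℕ, (q : ℝ) ^ n * Metric.diam (univ : Set X) < δ := by
    have : Filter.Tendsto (fun n : ℕ => (q : ℝ) ^ n * Metric.diam (univ : Set X)) Filter.atTop
        (𝓝 (0 * Metric.diam (univ : Set X))) :=
      (tendsto_pow_atTop_nhds_zero_of_lt_one q.2 (by exact_mod_cast hq)).mul_const _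
    rw [zero_mul] at this
    exact (this.eventually (gt_mem_nhds hδ)).exists
  refine ⟨n, fun l hl hlF => ?_⟩
  obtain ⟨x₀⟩ := hX
  obtain ⟨U, hU, hball⟩ := hLeb (l.foldr (fun f g => f ∘ g) id x₀) (mem_univ _)
  refine ⟨U, hU, ?_⟩
  rintro _ ⟨y, rfl⟩
  refine hball (lt_of_le_of_lt ((hcomp l hlF).dist_le_mul y x₀) ?_)
  rw [hl]
  refine lt_of_le_of_lt ?_ hn
  push_cast
  gcongr
  exact Metric.dist_le_diam_of_mem isCompact_univ.isBounded (mem_univ _) (mem_univ _)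

/-! ### The height of a topological fractal is not a limit ordinal -/

lemma accPt_biUnion_iff {X : Type*} [TopologicalSpace X] {κ : Type*} {s : Set κ} (hs : s.Finite)
    {B : κ → Set X} {x : X} :
    AccPt x (Filter.principal (⋃ k ∈ s, B k)) ↔ ∃ k ∈ s, AccPt x (Filter.principal (B k)) := by
  induction s, hs using Set.Finite.induction_on with
  | empty => simp [AccPt]
  | insert _ _ ih => simp [← Filter.sup_principal, accPt_sup, ih]

/-- A continuous map from a compact space does not create accumulation points. -/
lemma AccPt.exists_of_image {X Y : Type*} [TopologicalSpace X] [T1Space X] [TopologicalSpace Y]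
    [T3Space Y]
    {f : X → Y} (hf : Continuous f) {A : Set X} (hA : IsCompact A) {y : Y}
    (hy : AccPt y (Filter.principal (f '' A))) :
    ∃ x ∈ A, AccPt x (Filter.principal A) ∧ f x = y := by
  by_contra! h
  have hcl : IsCompact (A ∩ derivedSet A) := hA.inter_right (isClosed_derivedSet A)
  have hyn : y ∉ f '' (A ∩ derivedSet A) := by
    rintro ⟨x, ⟨hxA, hx⟩, rfl⟩
    exact h x hxA hx rfl
  obtain ⟨N, ⟨hN, hNc⟩, hNs⟩ := (closed_nhds_basis y).mem_iff.1
    ((hcl.image hf).isClosed.isOpen_compl.mem_nhds hyn)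
  have hfin : (A ∩ f ⁻¹' N).Finite := by
    by_contra hinf
    obtain ⟨x, hx, hacc⟩ := Set.Infinite.exists_accPt_of_subset_isCompact hinf
      (hA.inter_right (hNc.preimage hf)) Subset.rfl
    exact hNs hx.2 ⟨x, ⟨hx.1, hacc.mono (Filter.principal_mono.2 inter_subset_left)⟩, rfl⟩
  have hinf : (f '' A ∩ N).Infinite := by
    have h1 : AccPt y (Filter.principal (f '' A ∩ N)) := by
      rw [accPt_iff_frequently] at hy ⊢
      exact (hy.and_eventually hN).mono fun z hz => ⟨hz.1.1, hz.1.2, hz.2⟩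
    intro hfin
    rw [accPt_iff_clusterPt] at h1
    have : y ∈ closure ((f '' A ∩ N) \ {y}) := by
      rw [mem_closure_iff_clusterPt]
      convert! h1 using 1
      rw [Filter.inf_principal, sdiff_eq, inter_comm]
    rw [(hfin.subset sdiff_subset).isClosed.closure_eq] at this
    exact this.2 rfl
  exact hinf ((hfin.image f).subset (by rintro _ ⟨⟨x, hx, rfl⟩, hxN⟩; exact ⟨x, ⟨hx, hxN⟩, rfl⟩))

/-- A finite covering system of continuous maps covers every derivative by the images of that
derivative: heights cannot be raised by continuous maps. -/
lemma iteratedDerivedSet_subset_biUnion_image {X : Type*} [TopologicalSpace X] [CompactSpace X]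
    [T2Space X] {F : Set (X → X)} (hF : F.Finite) (hcont : ∀ f ∈ F, Continuous f)
    (hcov : CoversByImages F) (a : Ordinal) :
    (univ : Set X)ᵈ[a] ⊆ ⋃ f ∈ F, f '' (univ : Set X)ᵈ[a] := by
  induction a using Ordinal.limitRecOn with
  | zero => simpa [CoversByImages] using hcov
  | add_one a ih =>
    intro x hx
    have hacc := (mem_iteratedDerivedSet_succ.1 hx).1.mono (Filter.principal_mono.2 ih)
    obtain ⟨f, hf, hfacc⟩ := (accPt_biUnion_iff hF).1 hacc
    obtain ⟨y, hy, hyacc, rfl⟩ := hfacc.exists_of_image (hcont f hf)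
      (isClosed_iteratedDerivedSet_univ a).isCompact
    exact mem_biUnion hf ⟨y, mem_iteratedDerivedSet_succ.2 ⟨hyacc, hy⟩, rfl⟩
  | limit a ha ih =>
    intro x hx
    by_contra hcon
    simp only [mem_iUnion, not_exists] at hcon
    have hex : ∀ f ∈ F, ∃ b < a, f ⁻¹' {x} ∩ (univ : Set X)ᵈ[b] = ∅ := by
      intro f hf
      refine exists_inter_iteratedDerivedSet_eq_empty
        (isClosed_singleton.preimage (hcont f hf)).isCompact ha ?_
      rw [eq_empty_iff_forall_notMem]
      rintro y ⟨hy, hya⟩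
      exact hcon f hf ⟨y, hya, hy⟩
    choose! b hb hbx using hex
    obtain ⟨c, hc, hbc⟩ : ∃ c < a, ∀ f ∈ F, b f ≤ c := by
      refine ⟨hF.toFinset.sup b, ?_, fun f hf => Finset.le_sup (hF.mem_toFinset.2 hf)⟩
      rw [Finset.sup_lt_iff (bot_lt_iff_ne_bot.2 ha.ne_bot)]
      exact fun f hf => hb f (hF.mem_toFinset.1 hf)
    have hxc := ih c hc (iteratedDerivedSet_antitone _ hc.le hx)
    simp only [mem_iUnion] at hxc
    obtain ⟨f, hf, y, hy, rfl⟩ := hxc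
    exact (hbx f hf ▸ ⟨rfl, iteratedDerivedSet_antitone _ (hbc f hf) hy⟩ : y ∈ (∅ : Set X))

lemma scatteredHeight_of_isEmpty {X : Type*} [TopologicalSpace X] [IsEmpty X] :
    scatteredHeight X = (0 : Ordinal) := by
  have hX : IsScatteredSpace X := fun A ⟨x, _⟩ => isEmptyElim x
  rw [scatteredHeight, if_pos hX, ciSup_of_empty]
  rfl

/-- If the height were a limit ordinal `a`, a point `x` of large height below `a` near a point `d`
of height `a` would have a preimage of the same kind under some map of the system, near a point
sent to `d`. Iterating, `x` and `d` stay in a common set `f₁ ∘ ⋯ ∘ fₙ (X)` for every `n`. -/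
lemma IsTopologicalFractal.not_isCountableLimitOrdinal {X : Type*} [TopologicalSpace X]
    [CompactSpace X] (h : IsTopologicalFractal X) :
    ¬ IsCountableLimitOrdinal (scatteredHeight X) := by
  rintro ⟨a, ha, -, hlim⟩
  obtain ⟨_, F, hF, hcont, hcov, hcontr⟩ := h
  have hX : IsScatteredSpace X := by
    by_contra hX
    rw [scatteredHeight, if_neg hX] at ha
    exact WithTop.top_ne_coe ha
  rcases isEmpty_or_nonempty X with hemp | hne
  · rw [scatteredHeight_of_isEmpty, WithTop.coe_eq_coe] at ha
    exact hlim.ne_bot ha.symm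
  obtain ⟨a', ha', hTne, hTfin, hTemp⟩ := hX.exists_scatteredHeight_eq
  obtain rfl : a = a' := WithTop.coe_eq_coe.1 (ha.symm.trans ha')
  set T : Set X := (univ : Set X)ᵈ[a] with hT
  obtain ⟨V, hV, hVdisj⟩ := hTfin.t2_separation
  -- `b y` is an order below `a` whose derivative misses `y`.
  have hb : ∀ y : X, y ∉ T → ∃ b < a, y ∉ (univ : Set X)ᵈ[b] := by
    intro y hy
    rw [hT, iteratedDerivedSet_limit hlim, mem_iInter] at hy
    push Not at hy
    obtain ⟨⟨b, hb⟩, hyb⟩ := hy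
    exact ⟨b, hb, hyb⟩
  choose! b hba hyb using hb
  classical
  let N : (X → X) → X → Set X := fun f d =>
    if f d ∈ T then f ⁻¹' V (f d) else f ⁻¹' ((univ : Set X)ᵈ[b (f d)])ᶜ
  let U : X → Set X := fun d => V d ∩ ⋂ f ∈ F, N f d
  have hUo : ∀ d, IsOpen (U d) := by
    intro d
    refine (hV d).2.inter (hF.isOpen_biInter fun f hf => ?_)
    simp only [N]
    split_ifs
    · exact (hV _).2.preimage (hcont f hf)
    · exact (isClosed_iteratedDerivedSet_univ _).isOpen_compl.preimage (hcont f hf)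
  have hdU : ∀ d, d ∈ U d := by
    intro d
    refine ⟨(hV d).1, mem_iInter₂.2 fun f hf => ?_⟩
    simp only [N]
    split_ifs with hfd
    · exact (hV (f d)).1
    · exact hyb _ hfd
  obtain ⟨b₀, hb₀, hKb₀⟩ := exists_inter_iteratedDerivedSet_eq_empty
    (K := (⋃ d ∈ T, U d)ᶜ) (isOpen_biUnion fun d _ => hUo d).isClosed_compl.isCompact hlim (by
      rw [eq_empty_iff_forall_notMem]
      rintro x ⟨hx, hxT⟩
      exact hx (mem_biUnion hxT (hdU x)))
  obtain ⟨β, hβ, hb₀β, hbβ⟩ : ∃ β < a, b₀ ≤ β ∧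
      ∀ f ∈ F, ∀ d ∈ T, f d ∉ T → b (f d) ≤ β := by
    have hfin : {y | y ∉ T ∧ ∃ f ∈ F, ∃ d ∈ T, f d = y}.Finite :=
      (Set.Finite.image2 (fun (f : X → X) d => f d) hF hTfin).subset fun y hy => hy.2
    refine ⟨max b₀ (hfin.toFinset.sup b), max_lt hb₀ ?_, le_max_left _ _,
      fun f hf d hd hfd => le_max_of_le_right ?_⟩
    · rw [Finset.sup_lt_iff (bot_lt_iff_ne_bot.2 hlim.ne_bot)]
      exact fun y hy => hba y (hfin.mem_toFinset.1 hy).1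
    · exact Finset.le_sup (f := b) (hfin.mem_toFinset.2 ⟨hfd, f, hf, d, hd, rfl⟩)
  have hcovU : ∀ x ∈ (univ : Set X)ᵈ[β], ∃ d ∈ T, x ∈ U d := by
    intro x hx
    by_contra! hcon
    refine (hKb₀ ▸ ⟨?_, iteratedDerivedSet_antitone _ hb₀β hx⟩ : x ∈ (∅ : Set X))
    simpa using hcon
  have hstep : ∀ n : ℕ, ∀ x d, x ∈ (univ : Set X)ᵈ[β] → x ∉ T → d ∈ T → x ∈ U d →
      ∃ l : List (X → X), l.length = n ∧ (∀ f ∈ l, f ∈ F) ∧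
        x ∈ range (l.foldr (fun f g => f ∘ g) id) ∧
        d ∈ range (l.foldr (fun f g => f ∘ g) id) := by
    intro n
    induction n with
    | zero => exact fun x d _ _ _ _ => ⟨[], rfl, by simp, by simp, by simp⟩
    | succ n ih =>
      intro x d hxβ hxT hdT hxU
      have := iteratedDerivedSet_subset_biUnion_image hF hcont hcov β hxβ
      simp only [mem_iUnion] at this
      obtain ⟨f, hf, y, hy, rfl⟩ := this
      obtain ⟨e, heT, hyU⟩ := hcovU y hy
      have hyN : y ∈ N f e := mem_iInter₂.1 hyU.2 f hf
      have hfe : f e ∈ T := by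
        by_contra hfe
        simp only [N, if_neg hfe] at hyN
        exact hyN (iteratedDerivedSet_antitone _ (hbβ f hf e heT hfe) hxβ)
      simp only [N, if_pos hfe] at hyN
      have hfed : f e = d := by
        by_contra hne
        exact (hVdisj hfe hdT hne).notMem_of_mem_left hyN hxU.1
      have hyT : y ∉ T := by
        intro hyT
        have hye : y = e := by
          by_contra hne
          exact (hVdisj hyT heT hne).notMem_of_mem_left (hV y).1 hyU.1
        exact hxT (hye ▸ hfe)
      obtain ⟨l, hl, hlF, ⟨y', hy'⟩, ⟨e', he'⟩⟩ := ih y e hy hyT heT hyU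
      refine ⟨f :: l, by simp [hl], ?_, ⟨y', ?_⟩, ⟨e', ?_⟩⟩
      · simpa using ⟨hf, hlF⟩
      · simp [hy']
      · simp [he', hfed]
  obtain ⟨x, hxβ, hxβ'⟩ : ∃ x ∈ (univ : Set X)ᵈ[β], x ∉ (univ : Set X)ᵈ[β + 1] := by
    by_contra! hcon
    exact hX.iteratedDerivedSet_succ_ne (hTne.mono (iteratedDerivedSet_antitone _ hβ.le))
      (Subset.antisymm (iteratedDerivedSet_antitone _ (by simp)) hcon)
  have hxT : x ∉ T := fun hx =>
    hxβ' (iteratedDerivedSet_antitone _ (Order.add_one_le_of_lt hβ) hx)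
  obtain ⟨d, hdT, hxd⟩ := hcovU x hxβ
  have hne' : x ≠ d := fun h => hxT (h ▸ hdT)
  obtain ⟨n, hn⟩ := hcontr {{x}ᶜ, {d}ᶜ} (by simp) (by
    rw [sUnion_pair, eq_univ_iff_forall]
    intro y
    by_cases hy : y = x
    · exact Or.inr (by simpa [hy] using hne')
    · exact Or.inl hy)
  obtain ⟨l, hl, hlF, hxl, hdl⟩ := hstep n x d hxβ hxT hdT hxd
  obtain ⟨W, hW, hlW⟩ := hn l hl hlF
  rcases hW with rfl | rfl
  · exact hlW hxl rfl
  · exact hlW hdl rfl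

/-! ### Binary sequences -/

/-- The shift on binary sequences. -/
def seqTail (z : ℕ → Bool) : ℕ → Bool := fun n => z (n + 1)

/-- Prepend a bit to a binary sequence. -/
def seqCons (b : Bool) (z : ℕ → Bool) : ℕ → Bool
  | 0 => b
  | n + 1 => z n

@[simp] lemma seqCons_zero (b : Bool) (z : ℕ → Bool) : seqCons b z 0 = b := rfl

@[simp] lemma seqTail_seqCons (b : Bool) (z : ℕ → Bool) : seqTail (seqCons b z) = z := rfl

lemma continuous_seqTail : Continuous seqTail :=
  continuous_pi fun n => continuous_apply (n + 1)

/-- The set of binary sequences with prefix `t`. -/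
def prefixSet : List Bool → Set (ℕ → Bool)
  | [] => univ
  | b :: t => {z | z 0 = b ∧ seqTail z ∈ prefixSet t}

@[simp] lemma prefixSet_nil : prefixSet [] = univ := rfl

@[simp] lemma mem_prefixSet_cons {b : Bool} {t : List Bool} {z : ℕ → Bool} :
    z ∈ prefixSet (b :: t) ↔ z 0 = b ∧ seqTail z ∈ prefixSet t := Iff.rfl

lemma isOpen_prefixSet (t : List Bool) : IsOpen (prefixSet t) := by
  induction t with
  | nil => exact isOpen_univ
  | cons b t ih =>
    exact ((isOpen_discrete {b}).preimage (continuous_apply 0)).inter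
      (ih.preimage continuous_seqTail)

lemma prefixSet_append_true (t : List Bool) :
    prefixSet (t ++ [true]) = prefixSet t \ prefixSet (t ++ [false]) := by
  induction t with
  | nil => ext z; simp
  | cons b t ih =>
    ext z
    simp only [List.cons_append, mem_prefixSet_cons, ih, mem_sdiff]
    tauto

lemma prefixSet_append_subset (s t : List Bool) : prefixSet (s ++ t) ⊆ prefixSet s := by
  induction s with
  | nil => simp
  | cons b s ih => exact fun z hz => ⟨hz.1, ih hz.2⟩

lemma exists_prefixSet_subset_cylinder (n : ℕ) (z : ℕ → Bool) :
    ∃ t, z ∈ prefixSet t ∧ prefixSet t ⊆ PiNat.cylinder z n := by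
  induction n generalizing z with
  | zero => exact ⟨[], trivial, by simp⟩
  | succ n ih =>
    obtain ⟨t, ht, hts⟩ := ih (seqTail z)
    refine ⟨z 0 :: t, ⟨rfl, ht⟩, fun w hw => ?_⟩
    rw [PiNat.mem_cylinder_iff]
    rintro (_ | i) hi
    · exact hw.1
    · exact PiNat.mem_cylinder_iff.1 (hts hw.2) i (by omega)

/-- A clopen set of binary sequences is a finite union of prefix sets. -/
lemma IsClopen.exists_finite_prefixSet {W : Set (ℕ → Bool)} (hW : IsClopen W) :
    ∃ s : Finset (List Bool), W = ⋃ t ∈ s, prefixSet t := by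
  have hex : ∀ z ∈ W, ∃ t, z ∈ prefixSet t ∧ prefixSet t ⊆ W := by
    intro z hz
    obtain ⟨_, ⟨x, n, rfl⟩, hzx, hsub⟩ :=
      (PiNat.isTopologicalBasis_cylinders fun _ : ℕ => Bool).exists_subset_of_mem_open hz
        hW.isOpen
    obtain ⟨t, hzt, ht⟩ := exists_prefixSet_subset_cylinder n z
    rw [PiNat.mem_cylinder_iff_eq.1 hzx] at ht
    exact ⟨t, hzt, ht.trans hsub⟩
  obtain ⟨s, hs, hsfin, hcov⟩ := hW.isClosed.isCompact.elim_finite_subcover_image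
    (b := {t | prefixSet t ⊆ W}) (c := prefixSet) (fun t _ => isOpen_prefixSet t) (by
      intro z hz
      obtain ⟨t, hzt, ht⟩ := hex z hz
      exact mem_biUnion ht hzt)
  refine ⟨hsfin.toFinset, Subset.antisymm (by simpa using hcov) ?_⟩
  simp only [Finite.mem_toFinset]
  exact iUnion₂_subset fun t ht => hs ht

/-- The prefix code `0 ↦ 0`, `1 ↦ 10` on binary words; the remaining code word `11` is free. -/
def prefixCode : List Bool → List Bool
  | [] => []
  | false :: t => false :: prefixCode t
  | true :: t => true :: false :: prefixCode t

lemma prefixCode_append (s t : List Bool) :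
    prefixCode (s ++ t) = prefixCode s ++ prefixCode t := by
  induction s with
  | nil => rfl
  | cons b s ih => cases b <;> simp [prefixCode, ih]

lemma count_true_prefixCode (t : List Bool) : (prefixCode t).count true = t.count true := by
  induction t with
  | nil => rfl
  | cons b t ih => cases b <;> simp [prefixCode, ih]

lemma takeWhile_prefixCode (t : List Bool) :
    (prefixCode t).takeWhile (! ·) = t.takeWhile (! ·) := by
  induction t with
  | nil => rfl
  | cons b t ih => cases b <;> simp [prefixCode, ih]

/-- Induction along the operation `b :: t ↦ prefixCode t` on binary words. It terminates, since
dropping a letter `1` lowers the number of ones, and dropping a letter `0` keeps that number and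
lowers the number of leading zeros. -/
lemma prefixCode_induction {P : List Bool → Prop} (nil : P [])
    (cons : ∀ b t, P (prefixCode t) → P (b :: t)) (t : List Bool) : P t := by
  suffices h : ∀ k a, ∀ t : List Bool, t.count true = k → (t.takeWhile (! ·)).length = a → P t from
    h _ _ t rfl rfl
  intro k
  induction k using Nat.strong_induction_on with
  | _ k ihk =>
    intro a
    induction a with
    | zero =>
      rintro (_ | ⟨_ | _, t⟩) hk ha
      · exact nil
      · simp at ha
      · refine cons _ _ (ihk (t.count true) (by simp at hk; omega) _ _ ?_ rfl)
        rw [count_true_prefixCode]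
    | succ a iha =>
      rintro (_ | ⟨_ | _, t⟩) hk ha
      · exact nil
      · refine cons _ _ (iha _ ?_ ?_)
        · rw [count_true_prefixCode]
          simpa using hk
        · rw [takeWhile_prefixCode]
          simpa using ha
      · simp at ha

/-! ### Binary schemes of clopen sets -/

/-- A binary scheme: each node `ν` carries a clopen set, which contains the disjoint sets of its two
children, of at most half the diameter. What the children leave over, the residue of `ν`, is the
range of the continuous map `residue ν` on the Cantor set; in particular it is nonempty. -/
structure BinaryScheme (X : Type*) [MetricSpace X] (N : Type*) where
  /-- the set carried by a node -/
  carrier : N → Set X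
  /-- the two children of a node -/
  child : N → Bool → N
  /-- a parametrization of the residue of a node by the Cantor set -/
  residue : N → (ℕ → Bool) → X
  isClopen_carrier : ∀ ν, IsClopen (carrier ν)
  child_subset : ∀ ν b, carrier (child ν b) ⊆ carrier ν
  disjoint_child : ∀ ν, Disjoint (carrier (child ν false)) (carrier (child ν true))
  diam_child : ∀ ν b, Metric.diam (carrier (child ν b)) ≤ Metric.diam (carrier ν) / 2
  continuous_residue : ∀ ν, Continuous (residue ν)
  range_residue : ∀ ν, range (residue ν) =
    carrier ν \ (carrier (child ν false) ∪ carrier (child ν true))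

namespace BinaryScheme

variable {X : Type*} [MetricSpace X] {N : Type*} (T : BinaryScheme X N)

lemma residue_mem (ν : N) (z : ℕ → Bool) : T.residue ν z ∈ T.carrier ν :=
  (T.range_residue ν ▸ mem_range_self z :
    T.residue ν z ∈ T.carrier ν \ (T.carrier (T.child ν false) ∪ T.carrier (T.child ν true))).1

lemma residue_notMem (ν : N) (z : ℕ → Bool) (b : Bool) :
    T.residue ν z ∉ T.carrier (T.child ν b) := by
  have := (T.range_residue ν ▸ mem_range_self z :
    T.residue ν z ∈ T.carrier ν \ (T.carrier (T.child ν false) ∪ T.carrier (T.child ν true))).2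
  cases b
  · exact fun h => this (Or.inl h)
  · exact fun h => this (Or.inr h)

/-- Finite approximations to `BinaryScheme.param`. -/
def approx : ℕ → N → (ℕ → Bool) → X
  | 0, ν, z => T.residue ν z
  | n + 1, ν, z =>
    if z 0 then
      if z 1 then T.residue ν (seqTail (seqTail z))
      else approx n (T.child ν true) (seqTail (seqTail z))
    else approx n (T.child ν false) (seqTail z)

lemma approx_mem (n : ℕ) (ν : N) (z : ℕ → Bool) : T.approx n ν z ∈ T.carrier ν := by
  induction n generalizing ν z with
  | zero => exact T.residue_mem ν z
  | succ n ih =>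
    rw [approx]
    split_ifs
    · exact T.residue_mem ν _
    · exact T.child_subset ν true (ih _ _)
    · exact T.child_subset ν false (ih _ _)

lemma half_pow_le (n : ℕ) (ν : N) (b : Bool) :
    Metric.diam (T.carrier (T.child ν b)) * (1 / 2) ^ n ≤
      Metric.diam (T.carrier ν) * (1 / 2) ^ (n + 1) := by
  have := T.diam_child ν b
  rw [pow_succ', ← mul_assoc]
  gcongr
  linarith

/-- The node reached from `ν` by following a binary word. -/
def node : N → List Bool → N
  | ν, [] => ν
  | ν, b :: t => node (T.child ν b) t

lemma node_subset (ν : N) (t : List Bool) : T.carrier (T.node ν t) ⊆ T.carrier ν := by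
  induction t generalizing ν with
  | nil => exact Subset.rfl
  | cons b t ih => exact (ih _).trans (T.child_subset ν b)

open Classical in
/-- The address of a point below a node: at each node, go to the child `false` if the point lies
in its set, and to the child `true` otherwise. A point of the residue of `ν` has the
address `111…` below `ν`, since it lies in no set further down. -/
noncomputable def address : N → X → ℕ → Bool
  | ν, x, 0 => decide (x ∉ T.carrier (T.child ν false))
  | ν, x, n + 1 => address (T.child ν (decide (x ∉ T.carrier (T.child ν false)))) x n

lemma continuous_address (ν : N) : Continuous (T.address ν) := by
  classical
  have hdec : ∀ ν, Continuous fun x => decide (x ∉ T.carrier (T.child ν false)) := fun ν => by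
    rw [continuous_bool_rng false]
    convert T.isClopen_carrier (T.child ν false) using 1
    ext x
    simp
  refine continuous_pi fun n => ?_
  induction n generalizing ν with
  | zero => exact hdec ν
  | succ n ih =>
    rw [continuous_iff_continuousAt]
    intro x
    refine (ih (T.child ν (decide (x ∉ T.carrier (T.child ν false))))).continuousAt.congr ?_
    filter_upwards [(hdec ν).continuousAt.eventually (isOpen_discrete {_} |>.mem_nhds rfl)]
      with y hy
    rw [address, hy]

lemma address_mem_prefixSet_iff (ν : N) (t : List Bool) (x : X) :
    T.address ν x ∈ prefixSet (t ++ [false]) ↔ x ∈ T.carrier (T.node ν (t ++ [false])) := by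
  classical
  have hz : ∀ ν, T.address ν x 0 = decide (x ∉ T.carrier (T.child ν false)) := fun _ => rfl
  have htl : ∀ ν, seqTail (T.address ν x) =
    T.address (T.child ν (decide (x ∉ T.carrier (T.child ν false)))) x := fun _ => rfl
  induction t generalizing ν with
  | nil => simp [hz, node]
  | cons b t ih =>
    have hsub := T.node_subset (T.child ν b) (t ++ [false])
    have hdisj := fun (h : x ∈ T.carrier (T.child ν false))
      (h' : x ∈ T.carrier (T.child ν true)) => (T.disjoint_child ν).notMem_of_mem_left h h'
    simp only [List.cons_append, mem_prefixSet_cons, hz, htl, node]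
    by_cases hx : x ∈ T.carrier (T.child ν false) <;> cases b <;> simp [hx, ih]
    · exact fun h => hdisj hx (hsub h)
    · exact fun h => hx (hsub h)

variable [CompactSpace X]

lemma dist_le_diam {ν : N} {x y : X} (hx : x ∈ T.carrier ν) (hy : y ∈ T.carrier ν) :
    dist x y ≤ Metric.diam (T.carrier ν) :=
  Metric.dist_le_diam_of_mem (isCompact_univ.isBounded.subset (subset_univ _)) hx hy

lemma dist_approx_le (n : ℕ) (ν : N) (z : ℕ → Bool) :
    dist (T.approx n ν z) (T.approx (n + 1) ν z) ≤
      Metric.diam (T.carrier ν) * (1 / 2) ^ n := by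
  induction n generalizing ν z with
  | zero => simpa using T.dist_le_diam (T.approx_mem 0 ν z) (T.approx_mem 1 ν z)
  | succ n ih =>
    rw [approx, approx]
    split_ifs
    · rw [dist_self]
      have := Metric.diam_nonneg (s := T.carrier ν)
      positivity
    · exact (ih _ _).trans (T.half_pow_le n ν true)
    · exact (ih _ _).trans (T.half_pow_le n ν false)

lemma exists_tendsto_approx (ν : N) (z : ℕ → Bool) :
    ∃ x, Filter.Tendsto (fun n => T.approx n ν z) Filter.atTop (𝓝 x) :=
  cauchySeq_tendsto_of_complete
    (cauchySeq_of_le_geometric (1 / 2) _ (by norm_num) fun n => T.dist_approx_le n ν z)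

/-- The parametrization of the set of a node by the Cantor set: a sequence `0z` is sent to where
the child `false` sends `z`, a sequence `10z` to where the child `true` sends `z`, and a sequence
`11z` to the point of the residue with parameter `z`. -/
noncomputable def param (ν : N) (z : ℕ → Bool) : X := (T.exists_tendsto_approx ν z).choose

lemma tendsto_approx (ν : N) (z : ℕ → Bool) :
    Filter.Tendsto (fun n => T.approx n ν z) Filter.atTop (𝓝 (T.param ν z)) :=
  (T.exists_tendsto_approx ν z).choose_spec

lemma param_mem (ν : N) (z : ℕ → Bool) : T.param ν z ∈ T.carrier ν :=
  (T.isClopen_carrier ν).isClosed.mem_of_tendsto (T.tendsto_approx ν z)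
    (Filter.Eventually.of_forall fun n => T.approx_mem n ν z)

lemma param_eq (ν : N) (z : ℕ → Bool) : T.param ν z =
    if z 0 then
      if z 1 then T.residue ν (seqTail (seqTail z))
      else T.param (T.child ν true) (seqTail (seqTail z))
    else T.param (T.child ν false) (seqTail z) := by
  refine tendsto_nhds_unique ((Filter.tendsto_add_atTop_iff_nat 1).2 (T.tendsto_approx ν z)) ?_
  simp only [approx]
  split_ifs
  · exact tendsto_const_nhds
  · exact T.tendsto_approx _ _
  · exact T.tendsto_approx _ _

lemma eventually_dist_param_le (n : ℕ) (ν : N) (z : ℕ → Bool) {ε : ℝ} (hε : 0 < ε) :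
    ∀ᶠ w in 𝓝 z, dist (T.param ν w) (T.param ν z) ≤
      Metric.diam (T.carrier ν) * (1 / 2) ^ n + ε := by
  induction n generalizing ν z with
  | zero =>
    refine Filter.Eventually.of_forall fun w => ?_
    have := T.dist_le_diam (T.param_mem ν w) (T.param_mem ν z)
    linarith
  | succ n ih =>
    have h0 : ∀ᶠ w in 𝓝 z, w 0 = z 0 :=
      (continuous_apply 0).continuousAt.eventually (isOpen_discrete {z 0} |>.mem_nhds rfl)
    have h1 : ∀ᶠ w in 𝓝 z, w 1 = z 1 :=
      (continuous_apply 1).continuousAt.eventually (isOpen_discrete {z 1} |>.mem_nhds rfl)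
    have hd := Metric.diam_nonneg (s := T.carrier ν)
    by_cases hz0 : z 0
    · by_cases hz1 : z 1
      · have hc : Continuous fun w => T.residue ν (seqTail (seqTail w)) :=
          (T.continuous_residue ν).comp (continuous_seqTail.comp continuous_seqTail)
        have hε' : ∀ᶠ w in 𝓝 z, dist (T.residue ν (seqTail (seqTail w)))
            (T.residue ν (seqTail (seqTail z))) < ε :=
          hc.continuousAt.eventually (Metric.ball_mem_nhds _ hε)
        filter_upwards [h0, h1, hε'] with w hw0 hw1 hw
        rw [param_eq, param_eq T ν z]
        simp only [hw0, hw1, hz0, hz1, if_true]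
        have : 0 ≤ Metric.diam (T.carrier ν) * (1 / 2 : ℝ) ^ (n + 1) := by positivity
        linarith
      · filter_upwards [h0, h1, (continuous_seqTail.comp continuous_seqTail).continuousAt.eventually
          (ih (T.child ν true) (seqTail (seqTail z)))] with w hw0 hw1 hw
        rw [param_eq, param_eq T ν z]
        simp only [hw0, hw1, hz0, hz1, if_true]
        exact hw.trans (add_le_add_left (T.half_pow_le n ν true) _)
    · filter_upwards [h0, continuous_seqTail.continuousAt.eventually
          (ih (T.child ν false) (seqTail z))] with w hw0 hw
      rw [param_eq, param_eq T ν z]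
      simp only [hw0, hz0]
      exact hw.trans (add_le_add_left (T.half_pow_le n ν false) _)

lemma exists_mul_half_pow_lt (C : ℝ) {ε : ℝ} (hε : 0 < ε) : ∃ n : ℕ, C * (1 / 2) ^ n < ε := by
  have : Filter.Tendsto (fun n : ℕ => C * (1 / 2 : ℝ) ^ n) Filter.atTop (𝓝 (C * 0)) :=
    (tendsto_pow_atTop_nhds_zero_of_lt_one (by norm_num) (by norm_num)).const_mul C
  rw [mul_zero] at this
  exact (this.eventually (gt_mem_nhds hε)).exists

lemma continuous_param (ν : N) : Continuous (T.param ν) := by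
  rw [continuous_iff_continuousAt]
  intro z
  rw [Metric.continuousAt_iff']
  intro ε hε
  obtain ⟨n, hn⟩ := exists_mul_half_pow_lt (Metric.diam (T.carrier ν)) (half_pos hε)
  filter_upwards [T.eventually_dist_param_le n ν z (half_pos hε)] with w hw
  linarith

lemma exists_dist_param_le (n : ℕ) (ν : N) {x : X} (hx : x ∈ T.carrier ν) :
    ∃ z, dist (T.param ν z) x ≤ Metric.diam (T.carrier ν) * (1 / 2) ^ n := by
  induction n generalizing ν with
  | zero => exact ⟨fun _ => true, by simpa using T.dist_le_diam (T.param_mem ν _) hx⟩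
  | succ n ih =>
    by_cases h0 : x ∈ T.carrier (T.child ν false)
    · obtain ⟨z, hz⟩ := ih _ h0
      refine ⟨seqCons false z, ?_⟩
      rw [param_eq]
      simpa using hz.trans (T.half_pow_le n ν false)
    by_cases h1 : x ∈ T.carrier (T.child ν true)
    · obtain ⟨z, hz⟩ := ih _ h1
      refine ⟨seqCons true (seqCons false z), ?_⟩
      rw [param_eq]
      simpa [seqCons] using hz.trans (T.half_pow_le n ν true)
    · obtain ⟨z, rfl⟩ : x ∈ range (T.residue ν) := by
        rw [T.range_residue]
        exact ⟨hx, fun h => h.elim h0 h1⟩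
      refine ⟨seqCons true (seqCons true z), ?_⟩
      have := Metric.diam_nonneg (s := T.carrier ν)
      rw [param_eq]
      simp [seqCons]
      positivity

lemma range_param (ν : N) : range (T.param ν) = T.carrier ν := by
  refine Subset.antisymm (range_subset_iff.2 (T.param_mem ν)) fun x hx => ?_
  rw [← (isCompact_range (T.continuous_param ν)).isClosed.closure_eq, Metric.mem_closure_range_iff]
  intro ε hε
  obtain ⟨n, hn⟩ := exists_mul_half_pow_lt (Metric.diam (T.carrier ν)) hε
  obtain ⟨z, hz⟩ := T.exists_dist_param_le n ν hx
  exact ⟨z, by rw [dist_comm]; exact hz.trans_lt hn⟩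

lemma param_mem_node_iff (ν : N) (t : List Bool) (z : ℕ → Bool) :
    T.param ν z ∈ T.carrier (T.node ν t) ↔ z ∈ prefixSet (prefixCode t) := by
  induction t generalizing ν z with
  | nil => simpa [node, prefixCode] using T.param_mem ν z
  | cons b t ih =>
    have hdisj := fun x (h : x ∈ T.carrier (T.child ν false))
      (h' : x ∈ T.carrier (T.child ν true)) => (T.disjoint_child ν).notMem_of_mem_left h h'
    have hF := hdisj _ (T.param_mem (T.child ν false) (seqTail z))
    have hT := fun h => hdisj _ h (T.param_mem (T.child ν true) (seqTail (seqTail z)))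
    have hR := T.residue_notMem ν (seqTail (seqTail z)) b
    have hsub := T.node_subset (T.child ν b) t
    have htail : seqTail z 0 = z 1 := rfl
    rw [param_eq]
    cases b <;> cases h0 : z 0 <;> cases h1 : z 1 <;>
      simp only [prefixCode, node, mem_prefixSet_cons, h0, h1, htail, if_true, if_false,
        true_and, false_and, iff_false, reduceCtorEq, Bool.false_eq_true]
    · exact ih _ _
    · exact ih _ _
    · exact fun h => hT (hsub h)
    · exact fun h => hR (hsub h)
    · exact fun h => hF (hsub h)
    · exact fun h => hF (hsub h)
    · exact ih _ _
    · exact fun h => hR (hsub h)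

lemma address_surjective (ν : N) : Function.Surjective (T.address ν) := by
  intro z
  have hcl : IsClosed (range (T.address ν)) := (isCompact_range (T.continuous_address ν)).isClosed
  have hz : z ∈ closure (range (T.address ν)) := by
    rw [mem_closure_iff]
    intro O hO hzO
    obtain ⟨_, ⟨x, n, rfl⟩, hzx, hsub⟩ :=
      (PiNat.isTopologicalBasis_cylinders fun _ : ℕ => Bool).exists_subset_of_mem_open hzO hO
    obtain ⟨t, -, ht⟩ := exists_prefixSet_subset_cylinder n z
    rw [PiNat.mem_cylinder_iff_eq.1 hzx] at ht
    have hy := T.residue_mem (T.node ν (t ++ [false])) z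
    rw [← address_mem_prefixSet_iff] at hy
    exact ⟨_, hsub (ht (prefixSet_append_subset _ _ hy)), mem_range_self _⟩
  rwa [hcl.closure_eq] at hz

/-- The system of maps of a scheme with root `ν`: the address of a point is read as a parameter for
the two children of the root and for its residue. -/
noncomputable def system (ν : N) : Option Bool → X → X
  | some b, x => T.param (T.child ν b) (T.address ν x)
  | none, x => T.residue ν (T.address ν x)

lemma continuous_system (ν : N) (i : Option Bool) : Continuous (T.system ν i) := by
  cases i with
  | none => exact (T.continuous_residue ν).comp (T.continuous_address ν)
  | some b => exact (T.continuous_param _).comp (T.continuous_address ν)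

lemma resolved_address_preimage (ν : N) (t : List Bool) :
    Resolved (T.system ν) (T.address ν ⁻¹' prefixSet t) := by
  -- The preimages of the sets of nodes are governed by `b :: t ↦ prefixCode t`.
  have hfalse : ∀ t, Resolved (T.system ν) (T.address ν ⁻¹' prefixSet (t ++ [false])) := by
    intro t
    induction t using prefixCode_induction with
    | nil =>
      have : T.address ν ⁻¹' prefixSet ([] ++ [false]) = T.carrier (T.child ν false) := by
        ext x
        exact T.address_mem_prefixSet_iff ν [] x
      rw [this]
      refine Resolved.of_preimage ?_
      rintro (_ | _ | _)
      · convert resolved_empty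
        exact eq_empty_iff_forall_notMem.2 fun x => T.residue_notMem ν _ false
      · convert resolved_univ
        exact eq_univ_iff_forall.2 fun x => T.param_mem _ _
      · convert resolved_empty
        exact eq_empty_iff_forall_notMem.2 fun x h =>
          (T.disjoint_child ν).notMem_of_mem_left h (T.param_mem _ _)
    | cons b t ih =>
      have : T.address ν ⁻¹' prefixSet (b :: t ++ [false]) =
          T.carrier (T.node (T.child ν b) (t ++ [false])) := by
        ext x
        exact T.address_mem_prefixSet_iff ν (b :: t) x
      rw [this]
      have hsub := T.node_subset (T.child ν b) (t ++ [false])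
      refine Resolved.of_preimage ?_
      rintro (_ | c)
      · convert resolved_empty
        exact eq_empty_iff_forall_notMem.2 fun x h => T.residue_notMem ν _ b (hsub h)
      · by_cases hcb : c = b
        · subst hcb
          convert ih using 1
          ext x
          simpa [system, prefixCode_append, prefixCode] using
            T.param_mem_node_iff (T.child ν c) (t ++ [false]) (T.address ν x)
        · convert resolved_empty
          refine eq_empty_iff_forall_notMem.2 fun x h => ?_
          have hx := T.param_mem (T.child ν c) (T.address ν x)
          have hx' := hsub h
          cases b <;> cases c <;> first
            | exact hcb rfl
            | exact (T.disjoint_child ν).notMem_of_mem_left hx hx'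
            | exact (T.disjoint_child ν).notMem_of_mem_left hx' hx
  induction t using List.reverseRecOn with
  | nil => exact resolved_univ
  | append_singleton t b ih =>
    cases b
    · exact hfalse t
    · rw [prefixSet_append_true, preimage_sdiff]
      exact ih.diff (hfalse t)

lemma hasResolvingSystem {ν : N} (hν : T.carrier ν = univ) : HasResolvingSystem X := by
  have hres : ∀ W : Set (ℕ → Bool), IsClopen W →
      Resolved (T.system ν) (T.address ν ⁻¹' W) := by
    intro W hW
    obtain ⟨s, rfl⟩ := hW.exists_finite_prefixSet
    rw [preimage_iUnion₂]
    exact Resolved.biUnion s.finite_toSet fun t _ => T.resolved_address_preimage ν t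
  have hsome : ∀ b, range (T.system ν (some b)) = T.carrier (T.child ν b) := fun b => by
    rw [← T.range_param]
    exact (T.address_surjective ν).range_comp (T.param (T.child ν b))
  have hnone : range (T.system ν none) =
      T.carrier ν \ (T.carrier (T.child ν false) ∪ T.carrier (T.child ν true)) := by
    rw [← T.range_residue]
    exact (T.address_surjective ν).range_comp (T.residue ν)
  refine ⟨Option Bool, inferInstance, T.system ν, T.continuous_system ν, ?_, ?_, ?_⟩
  · have hd := T.disjoint_child ν
    rintro (_ | _ | _) (_ | _ | _) hij <;> simp only [hsome, hnone] <;>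
      first
      | exact absurd rfl hij
      | exact hd
      | exact hd.symm
      | exact disjoint_sdiff_left.mono_right subset_union_left
      | exact disjoint_sdiff_left.mono_right subset_union_right
      | exact disjoint_sdiff_right.mono_left subset_union_left
      | exact disjoint_sdiff_right.mono_left subset_union_right
  · rw [iUnion_option, hnone, hν, eq_univ_iff_forall]
    intro x
    simp only [hsome, mem_union, mem_sdiff, mem_univ, true_and, mem_iUnion, Bool.exists_bool]
    tauto
  · intro B hB
    refine Resolved.of_preimage ?_
    rintro (_ | b)
    · exact hres _ (hB.preimage (T.continuous_residue ν))
    · exact hres _ (hB.preimage (T.continuous_param _))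

end BinaryScheme

/-- The nodes are the clopen sets that meet a fixed perfect set: each of them contains two smaller
disjoint ones, and these can be chosen to leave out a third point. -/
lemma hasResolvingSystem_of_perfect {X : Type*} [TopologicalSpace X] [CompactSpace X]
    [MetrizableSpace X] (hzero : IsTopologicalBasis {s : Set X | IsClopen s}) {K : Set X}
    (hK : Perfect K) (hne : K.Nonempty) : HasResolvingSystem X := by
  let _ := metrizableSpaceMetric X
  let N := {A : Set X // IsClopen A ∧ (A ∩ K).Nonempty}
  have hsplit : ∀ A : N, ∃ (B : Bool → N) (r : (ℕ → Bool) → X), (∀ b, (B b).1 ⊆ A.1) ∧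
      Disjoint (B false).1 (B true).1 ∧
      (∀ b, Metric.diam (B b).1 ≤ Metric.diam A.1 / 2) ∧ Continuous r ∧
      range r = A.1 \ ((B false).1 ∪ (B true).1) := by
    rintro ⟨A, hA, x, hxA, hxK⟩
    have hacc := preperfect_iff_nhds.1 hK.acc x hxK
    obtain ⟨y, ⟨hyA, hyK⟩, hyx⟩ := hacc A (hA.isOpen.mem_nhds hxA)
    obtain ⟨z, ⟨⟨hzA, hzy⟩, hzK⟩, hzx⟩ := hacc (A ∩ {y}ᶜ)
      ((hA.isOpen.inter isOpen_compl_singleton).mem_nhds ⟨hxA, hyx.symm⟩)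
    have hxy : 0 < dist x y := dist_pos.2 hyx.symm
    have hd : 0 < Metric.diam A :=
      hxy.trans_le (Metric.dist_le_diam_of_mem (isCompact_univ.isBounded.subset (subset_univ A))
        hxA hyA)
    set ε := min (dist x y / 2) (Metric.diam A / 4) with hε
    have hε0 : 0 < ε := lt_min (half_pos hxy) (by linarith)
    have hsmall : ∀ p ∈ A, p ∈ K → p ≠ z → ∃ B : N, B.1 ⊆ A ∧ z ∉ B.1 ∧ B.1 ⊆ Metric.ball p ε := by
      intro p hpA hpK hpz
      obtain ⟨B, hB, hpB, hBs⟩ := hzero.exists_subset_of_mem_open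
        (show p ∈ A ∩ {z}ᶜ ∩ Metric.ball p ε from ⟨⟨hpA, hpz⟩, Metric.mem_ball_self hε0⟩)
        ((hA.isOpen.inter isOpen_compl_singleton).inter Metric.isOpen_ball)
      exact ⟨⟨B, hB, p, hpB, hpK⟩, fun q hq => (hBs hq).1.1, fun hq => (hBs hq).1.2 rfl,
        fun q hq => (hBs hq).2⟩
    -- The third point `z` makes the residue nonempty.
    obtain ⟨B₀, hB₀A, hzB₀, hB₀⟩ := hsmall x hxA hxK hzx.symm
    obtain ⟨B₁, hB₁A, hzB₁, hB₁⟩ := hsmall y hyA hyK fun h => hzy h.symm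
    have hdiam : ∀ (B : Set X) (p : X), B ⊆ Metric.ball p ε →
        Metric.diam B ≤ Metric.diam A / 2 := by
      intro B p hB
      refine (Metric.diam_mono hB Metric.isBounded_ball).trans
        ((Metric.diam_ball hε0.le).trans ?_)
      have : ε ≤ Metric.diam A / 4 := min_le_right _ _
      linarith
    let Y : Set X := A \ (B₀.1 ∪ B₁.1)
    have hYc : IsCompact Y := (hA.diff (B₀.2.1.union B₁.2.1)).isClosed.isCompact
    have : Nonempty Y := ⟨⟨z, hzA, fun h => h.elim hzB₀ hzB₁⟩⟩
    have : CompactSpace Y := isCompact_iff_compactSpace.1 hYc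
    obtain ⟨r, hr, hrs⟩ := exists_nat_bool_continuous_surjective_of_compact Y
    refine ⟨fun b => if b then B₁ else B₀, fun w => r w, ?_, ?_, ?_,
      continuous_subtype_val.comp hr, ?_⟩
    · rintro (_ | _)
      · exact hB₀A
      · exact hB₁A
    · refine (Metric.ball_disjoint_ball ?_).mono hB₀ hB₁
      have : ε ≤ dist x y / 2 := min_le_left _ _
      linarith
    · rintro (_ | _)
      · exact hdiam _ _ hB₀
      · exact hdiam _ _ hB₁
    · exact (hrs.range_comp Subtype.val).trans Subtype.range_coe
  choose B r hBA hBd hBdiam hr hrr using hsplit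
  let T : BinaryScheme X N :=
    { carrier := Subtype.val
      child := B
      residue := r
      isClopen_carrier := fun A => A.2.1
      child_subset := hBA
      disjoint_child := hBd
      diam_child := hBdiam
      continuous_residue := hr
      range_residue := hrr }
  exact T.hasResolvingSystem (ν := ⟨univ, isClopen_univ, by simpa using hne⟩) rfl

/-! ### Spaces of well-founded trees -/

/-- Well-founded trees of arbitrary branching. A tree without children is a leaf. -/
inductive WfTree : Type 1
  | mk (ι : Type) (c : ι → WfTree) : WfTree

namespace WfTree

universe u

open OnePoint

/-- The space of a tree: the one-point compactification of the disjoint sum of the spaces of its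
children. The point at infinity is the root, so the points of the space are the nodes. -/
def Space : WfTree → Type
  | mk ι c => OnePoint (Σ i : ι, (c i).Space)

/-- The topology of the space of a tree, by recursion on the tree. -/
@[reducible]
def spaceTopology : (t : WfTree) → TopologicalSpace t.Space
  | mk ι c =>
    letI := fun i => spaceTopology (c i)
    inferInstanceAs (TopologicalSpace (OnePoint (Σ i : ι, (c i).Space)))

instance (t : WfTree) : TopologicalSpace t.Space := t.spaceTopology

instance (t : WfTree) : CompactSpace t.Space := by
  cases t with
  | mk ι c => exact inferInstanceAs (CompactSpace (OnePoint (Σ i : ι, (c i).Space)))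

/-- The relation on a one-point compactification of a sum that relates infinity to itself, and
points of the same summand that are related there. -/
def SumRel {ι : Type} {P : ι → Type} (R : ∀ i, P i → P i → Prop)
    (x y : OnePoint (Σ i, P i)) : Prop :=
  (x = ∞ ∧ y = ∞) ∨ ∃ i a b, x = ((⟨i, a⟩ : Σ i, P i) : OnePoint (Σ i, P i)) ∧
    y = ((⟨i, b⟩ : Σ i, P i) : OnePoint (Σ i, P i)) ∧ R i a b

/-- Nodes are `n`-equivalent if they are equal or agree in the first `n` steps of the paths that
lead to them from the root. -/
def DepthEquiv : (t : WfTree) → ℕ → t.Space → t.Space → Prop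
  | mk _ c, n, x, y =>
    match n with
    | 0 => True
    | n + 1 => SumRel (fun i => DepthEquiv (c i) n) x y

lemma depthEquiv_zero (t : WfTree) (x y : t.Space) : DepthEquiv t 0 x y := by
  cases t; trivial

lemma DepthEquiv.of_succ {t : WfTree} {n : ℕ} {x y : t.Space} (h : DepthEquiv t (n + 1) x y) :
    DepthEquiv t n x y := by
  induction t generalizing n with
  | mk ι c ih =>
    cases n with
    | zero => trivial
    | succ n =>
      rcases h with h | ⟨i, a, b, hx, hy, h⟩
      · exact Or.inl h
      · exact Or.inr ⟨i, a, b, hx, hy, ih i h⟩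

lemma DepthEquiv.mono {t : WfTree} {n m : ℕ} (hnm : n ≤ m) {x y : t.Space}
    (h : DepthEquiv t m x y) : DepthEquiv t n x y := by
  induction hnm with
  | refl => exact h
  | step _ ih => exact ih h.of_succ

lemma _root_.IsCompact.finite_image_sigma_fst {ι : Type*} {P : ι → Type*}
    [∀ i, TopologicalSpace (P i)] {C : Set (Σ i, P i)} (hC : IsCompact C) :
    (Sigma.fst '' C).Finite := by
  let _ : TopologicalSpace ι := ⊥
  have : DiscreteTopology ι := ⟨rfl⟩
  have hcont : Continuous (Sigma.fst : (Σ i, P i) → ι) := continuous_sigma fun i => continuous_const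
  exact (hC.image hcont).finite_of_discrete

/-- An open set around infinity contains almost all summands. -/
lemma finite_setOf_coe_notMem {ι : Type*} {P : ι → Type*} [∀ i, TopologicalSpace (P i)]
    {V : Set (OnePoint (Σ i, P i))} (hV : IsOpen V) (h : ∞ ∈ V) :
    {i | ∃ a : P i, ((⟨i, a⟩ : Σ i, P i) : OnePoint (Σ i, P i)) ∉ V}.Finite := by
  refine ((OnePoint.isOpen_iff_of_mem h).1 hV).2.finite_image_sigma_fst.subset ?_
  rintro i ⟨a, ha⟩
  exact ⟨⟨i, a⟩, ha, rfl⟩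

/-- Maps on the summands, of which only finitely many meet each summand of the target, extend
continuously by sending infinity to infinity. -/
lemma continuous_elim_infty {ι κ : Type*} {P : ι → Type*} {Q : κ → Type*}
    [∀ i, TopologicalSpace (P i)] [∀ j, TopologicalSpace (Q j)] [∀ i, CompactSpace (P i)]
    (χ : ∀ i, P i → OnePoint (Σ j, Q j)) (hχ : ∀ i, Continuous (χ i))
    (hfin : ∀ j, {i | ∃ x q, χ i x = ((⟨j, q⟩ : Σ j, Q j) : OnePoint (Σ j, Q j))}.Finite) :
    Continuous fun p : OnePoint (Σ i, P i) => p.elim ∞ fun s => χ s.1 s.2 := by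
  rw [OnePoint.continuous_iff]
  refine ⟨?_, continuous_sigma hχ⟩
  rw [(nhds_basis_opens _).tendsto_right_iff]
  rintro V ⟨hVmem, hV⟩
  have hJ := finite_setOf_coe_notMem hV hVmem
  have hI := hJ.biUnion fun j _ => hfin j
  rw [Filter.eventually_iff, Filter.hasBasis_coclosedCompact.mem_iff]
  refine ⟨⋃ i ∈ _, range (Sigma.mk i), ⟨hI.isClosed_biUnion fun i _ => isClosed_range_sigmaMk,
    hI.isCompact_biUnion fun i _ => isCompact_range continuous_sigmaMk⟩, ?_⟩
  rintro ⟨i, x⟩ hx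
  by_contra hxV
  simp only [mem_ofPred_eq, OnePoint.elim_some] at hxV
  induction hy : χ i x using OnePoint.rec with
  | infty => exact hxV (hy ▸ hVmem)
  | coe s =>
    obtain ⟨j, q⟩ := s
    rw [hy] at hxV
    refine hx (mem_biUnion (x := i) ?_ ⟨x, rfl⟩)
    exact mem_biUnion (x := j) ⟨q, hxV⟩ ⟨x, q, hy⟩

/-- A map of tree spaces preserves depth if it is continuous and sends `n`-equivalent nodes to
`n`-equivalent nodes. -/
def PreservesDepth {t t' : WfTree} (φ : t.Space → t'.Space) : Prop :=
  Continuous φ ∧ ∀ n x y, DepthEquiv t n x y → DepthEquiv t' n (φ x) (φ y)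

/-- The inclusion of the space of a child. -/
def incl {ι : Type} (c : ι → WfTree) (i : ι) (x : (c i).Space) : (mk ι c).Space :=
  (((⟨i, x⟩ : Σ i, (c i).Space) : OnePoint (Σ i, (c i).Space)))

/-- The root of a tree, as a point of its space. -/
def root {ι : Type} (c : ι → WfTree) : (mk ι c).Space := (∞ : OnePoint (Σ i, (c i).Space))

section

variable {ι κ : Type} {c : ι → WfTree} {d : κ → WfTree}

lemma continuous_incl (i : ι) : Continuous (incl c i) :=
  (OnePoint.continuous_coe (X := Σ i, (c i).Space)).comp continuous_sigmaMk

lemma incl_ne_root (i : ι) (x : (c i).Space) : incl c i x ≠ root c :=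
  OnePoint.coe_ne_infty (X := Σ i, (c i).Space) _

lemma incl_eq_incl_iff {i j : ι} {x : (c i).Space} {y : (c j).Space} :
    incl c i x = incl c j y ↔ (⟨i, x⟩ : Σ i, (c i).Space) = ⟨j, y⟩ :=
  OnePoint.coe_eq_coe

lemma eq_root_or_exists_incl (x : (mk ι c).Space) : x = root c ∨ ∃ i a, x = incl c i a := by
  induction (x : OnePoint (Σ i, (c i).Space)) using OnePoint.rec with
  | infty => exact Or.inl rfl
  | coe s => exact Or.inr ⟨s.1, s.2, rfl⟩

lemma depthEquiv_succ_iff {n : ℕ} {x y : (mk ι c).Space} :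
    DepthEquiv (mk ι c) (n + 1) x y ↔ (x = root c ∧ y = root c) ∨
      ∃ i a b, x = incl c i a ∧ y = incl c i b ∧ DepthEquiv (c i) n a b :=
  Iff.rfl

/-- Gluing of maps on the children: each child is sent to the root or, preserving depth, to a child
of the target, each child of the target being used finitely often. -/
lemma exists_glue (χ : ∀ i, (c i).Space → (mk κ d).Space)
    (hχ : ∀ i, (∀ x, χ i x = root d) ∨ ∃ j φ, PreservesDepth φ ∧ ∀ x, χ i x = incl d j (φ x))
    (hfin : ∀ j, {i | ∃ x q, χ i x = incl d j q}.Finite) :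
    ∃ Φ : (mk ι c).Space → (mk κ d).Space, PreservesDepth Φ ∧ Φ (root c) = root d ∧
      ∀ i x, Φ (incl c i x) = χ i x := by
  have hcont : ∀ i, Continuous (χ i) := by
    intro i
    rcases hχ i with h | ⟨j, φ, hφ, h⟩
    · rw [funext h]
      exact continuous_const
    · rw [funext h]
      exact (continuous_incl j).comp hφ.1
  let Φ : (mk ι c).Space → (mk κ d).Space :=
    fun p : OnePoint (Σ i, (c i).Space) => p.elim (root d) fun s => χ s.1 s.2
  refine ⟨Φ, ⟨continuous_elim_infty (P := fun i => (c i).Space) (Q := fun j => (d j).Space)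
    χ hcont hfin, ?_⟩, rfl, fun _ _ => rfl⟩
  rintro (_ | n) x y h
  · trivial
  rcases depthEquiv_succ_iff.1 h with ⟨rfl, rfl⟩ | ⟨i, a, b, rfl, rfl, h₁⟩
  · exact Or.inl ⟨rfl, rfl⟩
  · show DepthEquiv _ _ (χ i a) (χ i b)
    rcases hχ i with h' | ⟨j, φ, hφ, h'⟩
    · rw [h', h']
      exact Or.inl ⟨rfl, rfl⟩
    · rw [h', h']
      exact Or.inr ⟨j, _, _, rfl, rfl, hφ.2 n a b h₁⟩

end

/-- A clopen set of nodes depends only on a bounded initial part of the paths from the root. -/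
lemma exists_depthEquiv_mem_iff {t : WfTree} {B : Set t.Space} (hB : IsClopen B) :
    ∃ n, ∀ x y, DepthEquiv t n x y → (x ∈ B ↔ y ∈ B) := by
  induction t with
  | mk ι c ih =>
    have key : ∀ B : Set (mk ι c).Space, IsClopen B → root c ∉ B →
        ∃ n, ∀ x y, DepthEquiv (mk ι c) n x y → (x ∈ B ↔ y ∈ B) := by
      intro B hB hroot
      have hfin := finite_setOf_coe_notMem (P := fun i => (c i).Space) (V := Bᶜ)
        hB.compl.isOpen hroot
      choose n hn using fun i => ih i (hB.preimage (continuous_incl (c := c) i))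
      obtain ⟨m, hm⟩ : ∃ m, ∀ i, (∃ a, incl c i a ∈ B) → n i ≤ m := by
        refine ⟨hfin.toFinset.sup n, fun i ⟨a, ha⟩ => Finset.le_sup (hfin.mem_toFinset.2 ⟨a, ?_⟩)⟩
        exact not_not.2 ha
      refine ⟨m + 1, fun x y h => ?_⟩
      rcases depthEquiv_succ_iff.1 h with ⟨rfl, rfl⟩ | ⟨i, a, b, rfl, rfl, h₁⟩
      · exact Iff.rfl
      · by_cases hi : ∃ a, incl c i a ∈ B
        · exact hn i a b (h₁.mono (hm i hi))
        · push Not at hi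
          exact iff_of_false (hi a) (hi b)
    by_cases hroot : root c ∈ B
    · obtain ⟨n, hn⟩ := key Bᶜ hB.compl (not_not.2 hroot)
      exact ⟨n, fun x y h => not_iff_not.1 (hn x y h)⟩
    · exact key B hB hroot

/-- The tree has rank `a`: its children have ranks below `a` and each ordinal below `a` is reached
by the ranks of infinitely many of them, so that the root is a point of height `a`. -/
def HasRank : WfTree → Ordinal.{u} → Prop
  | mk ι c, a => Countable ι ∧ ∃ b : ι → Ordinal.{u}, (∀ i, b i < a) ∧ (∀ i, HasRank (c i) (b i)) ∧
      ∀ γ < a, {i | γ ≤ b i}.Infinite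

/-- Representatives can be chosen distinct from countably many infinite sets. -/
lemma exists_injective_mem {κ ι : Type*} [Countable κ] (S : κ → Set ι)
    (hS : ∀ j, (S j).Infinite) : ∃ σ : κ → ι, Function.Injective σ ∧ ∀ j, σ j ∈ S j := by
  classical
  obtain ⟨e, he⟩ := exists_injective_nat κ
  choose t ht htc using fun j => (hS j).exists_subset_card_eq (e j + 1)
  obtain ⟨σ, hσ, hσt⟩ := (Finset.all_card_le_biUnion_card_iff_exists_injective t).1 (by
    intro s
    rcases s.eq_empty_or_nonempty with rfl | hs
    · simp
    -- The member of `s` with the largest index `e m` alone contributes `e m + 1 ≥ #s` elements.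
    · obtain ⟨m, hm, hmax⟩ := s.exists_max_image e hs
      calc s.card = (s.image e).card := (Finset.card_image_of_injective s he).symm
        _ ≤ (Finset.range (e m + 1)).card := Finset.card_le_card fun k hk => by
            obtain ⟨j, hj, rfl⟩ := Finset.mem_image.1 hk
            exact Finset.mem_range.2 (Nat.lt_succ_of_le (hmax j hj))
        _ = (t m).card := by rw [Finset.card_range, htc]
        _ ≤ _ := Finset.card_le_card (Finset.subset_biUnion_of_mem t hm))
  exact ⟨σ, hσ, fun j => ht j (hσt j)⟩

/-- A tree space maps onto every tree space of at most the same rank, preserving depth: distinct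
children of the source are matched with the children of the target, and the unmatched ones are sent
to the root. -/
lemma exists_surjective_preservesDepth {t' : WfTree} {a' : Ordinal.{u}} (h' : HasRank t' a')
    {t : WfTree} {a : Ordinal.{u}} (h : HasRank t a) (hle : a' ≤ a) :
    ∃ φ : t.Space → t'.Space, PreservesDepth φ ∧ Function.Surjective φ := by
  induction t' generalizing a' t a with
  | mk κ d ih =>
    cases t with
    | mk ι c =>
      obtain ⟨_, b', hb', hd, -⟩ := h'
      obtain ⟨_, b, hb, hc, hinf⟩ := h
      obtain ⟨σ, hσ, hσb⟩ := exists_injective_mem (fun j => {i | b' j ≤ b i})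
        fun j => hinf _ ((hb' j).trans_le hle)
      choose φ hφ hφs using fun j => ih j (hd j) (hc (σ j)) (hσb j)
      have hex : ∀ i, ∃ χ : (c i).Space → (mk κ d).Space,
          ((∀ j, σ j ≠ i) ∧ ∀ x, χ x = root d) ∨
          ∃ j, ∃ φ : (c i).Space → (d j).Space, σ j = i ∧ PreservesDepth φ ∧
            Function.Surjective φ ∧ ∀ x, χ x = incl d j (φ x) := by
        intro i
        by_cases hi : ∃ j, σ j = i
        · obtain ⟨j, rfl⟩ := hi
          exact ⟨fun x => incl d j (φ j x), Or.inr ⟨j, φ j, rfl, hφ j, hφs j, fun _ => rfl⟩⟩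
        · push Not at hi
          exact ⟨fun _ => root d, Or.inl ⟨hi, fun _ => rfl⟩⟩
      choose χ hχ using hex
      obtain ⟨Φ, hΦ, hroot, hincl⟩ := exists_glue χ
        (fun i => (hχ i).imp (fun h => h.2) fun ⟨j, ψ, _, h1, _, h2⟩ => ⟨j, ψ, h1, h2⟩) (by
          intro j
          refine (finite_singleton (σ j)).subset ?_
          rintro i ⟨x, q, hx⟩
          rcases hχ i with h | ⟨j', ψ, rfl, -, -, h⟩
          · rw [h.2] at hx
            exact absurd hx.symm (incl_ne_root _ _)
          · rw [h, incl_eq_incl_iff] at hx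
            rw [(Sigma.mk.inj_iff.1 hx).1]
            exact mem_singleton _)
      refine ⟨Φ, hΦ, fun y => ?_⟩
      rcases eq_root_or_exists_incl y with rfl | ⟨j, q, rfl⟩
      · exact ⟨_, hroot⟩
      · rcases hχ (σ j) with h | ⟨j', ψ, hj, -, hs, h⟩
        · exact absurd rfl (h.1 j)
        · obtain rfl := hσ hj
          obtain ⟨x, rfl⟩ := hs q
          exact ⟨incl c (σ j') x, by rw [hincl, h]⟩

lemma hasRank_mk_nat {c : ℕ → WfTree} {a : Ordinal.{u}} (hc : ∀ k, HasRank (c k) a) :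
    HasRank (mk ℕ c) (a + 1) :=
  ⟨inferInstance, fun _ => a, fun _ => Order.lt_add_one_iff.2 le_rfl, hc, fun γ hγ => by
    simpa [Order.lt_add_one_iff.1 hγ] using infinite_univ⟩

/-- The space of a tree with a sequence of children of the same rank has a resolving system of two
maps: the first one maps each child onto the next one, and the second one maps the whole space onto
the first child. The second map increases depth, and the first one can be repeated only finitely
often below a given child. -/
lemma hasResolvingSystem_of_hasRank {c : ℕ → WfTree} {a : Ordinal.{u}}
    (hc : ∀ k, HasRank (c k) a) : HasResolvingSystem (mk ℕ c).Space := by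
  obtain ⟨s, ⟨hs, hsd⟩, hss⟩ := exists_surjective_preservesDepth (hc 0) (hasRank_mk_nat hc)
    (Order.lt_add_one_iff.2 le_rfl).le
  choose φ hφ hφs using fun k => exists_surjective_preservesDepth (hc (k + 1)) (hc k) le_rfl
  obtain ⟨Φ, ⟨hΦ, hΦd⟩, hroot, hincl⟩ := exists_glue (fun k x => incl c (k + 1) (φ k x))
    (fun k => Or.inr ⟨k + 1, φ k, hφ k, fun _ => rfl⟩) (by
      intro j
      refine (finite_singleton (j - 1)).subset ?_
      rintro k ⟨x, q, hx⟩
      have := (Sigma.mk.inj_iff.1 (incl_eq_incl_iff.1 hx)).1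
      simp only [mem_singleton_iff]
      omega)
  let f : Bool → (mk ℕ c).Space → (mk ℕ c).Space := fun i =>
    if i then Φ else fun x => incl c 0 (s x)
  have hftrue : f true = Φ := rfl
  have hffalse : f false = fun x => incl c 0 (s x) := rfl
  have hne0 : ∀ x y, Φ x ≠ incl c 0 y := by
    intro x y h
    rcases eq_root_or_exists_incl x with rfl | ⟨k, z, rfl⟩
    · rw [hroot] at h
      exact incl_ne_root _ _ h.symm
    · rw [hincl, incl_eq_incl_iff] at h
      exact absurd (Sigma.mk.inj_iff.1 h).1 (Nat.succ_ne_zero k)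
  have hres : ∀ n, ∀ B : Set (mk ℕ c).Space,
      (∀ x y, DepthEquiv (mk ℕ c) n x y → (x ∈ B ↔ y ∈ B)) → IsClopen B → Resolved f B := by
    intro n
    induction n with
    | zero =>
      intro B hB _
      refine ⟨0, ?_⟩
      rcases B.eq_empty_or_nonempty with h | ⟨x, hx⟩
      · exact Or.inl h
      · exact Or.inr (eq_univ_iff_forall.2 fun y => (hB x y (depthEquiv_zero _ _ _)).1 hx)
    | succ n ih =>
      -- First the sets that meet only the first `m` children.
      have key : ∀ m, ∀ B : Set (mk ℕ c).Space,
          (∀ x y, DepthEquiv (mk ℕ c) (n + 1) x y → (x ∈ B ↔ y ∈ B)) → IsClopen B → root c ∉ B →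
          (∀ k x, incl c k x ∈ B → k < m) → Resolved f B := by
        intro m
        induction m with
        | zero =>
          intro B _ _ hr hm
          convert resolved_empty
          refine eq_empty_iff_forall_notMem.2 fun x hx => ?_
          rcases eq_root_or_exists_incl x with rfl | ⟨k, y, rfl⟩
          · exact hr hx
          · exact absurd (hm k y hx) (Nat.not_lt_zero k)
        | succ m ihm =>
          intro B hB hBc hr hm
          refine Resolved.of_preimage ?_
          rintro (_ | _)
          · rw [hffalse]
            refine ih _ (fun x y h => hB _ _ ?_) (hBc.preimage ((continuous_incl 0).comp hs))
            exact Or.inr ⟨0, _, _, rfl, rfl, hsd n x y h⟩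
          · rw [hftrue]
            refine ihm _ (fun x y h => hB _ _ (hΦd _ _ _ h)) (hBc.preimage hΦ)
              (by rwa [mem_preimage, hroot]) fun k x hx => ?_
            rw [mem_preimage, hincl] at hx
            have := hm _ _ hx
            omega
      have key' : ∀ B : Set (mk ℕ c).Space,
          (∀ x y, DepthEquiv (mk ℕ c) (n + 1) x y → (x ∈ B ↔ y ∈ B)) → IsClopen B → root c ∉ B →
          Resolved f B := by
        intro B hB hBc hr
        have hfin := finite_setOf_coe_notMem (P := fun i => (c i).Space) (V := Bᶜ)
          hBc.compl.isOpen hr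
        obtain ⟨m, hm⟩ := hfin.bddAbove
        exact key (m + 1) B hB hBc hr fun k x hx =>
          Nat.lt_succ_of_le (hm ⟨x, not_not.2 hx⟩)
      intro B hB hBc
      by_cases hr : root c ∈ B
      · have := key' Bᶜ (fun x y h => not_congr (hB x y h)) hBc.compl (not_not.2 hr)
        simpa using this.compl
      · exact key' B hB hBc hr
  refine ⟨Bool, inferInstance, f, ?_, ?_, ?_, ?_⟩
  · rintro (_ | _)
    · exact (continuous_incl 0).comp hs
    · exact hΦ
  · have : Disjoint (range (f true)) (range (f false)) := by
      rw [Set.disjoint_left]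
      rintro _ ⟨x, rfl⟩ ⟨y, hy⟩
      exact hne0 x (s y) hy.symm
    rintro (_ | _) (_ | _) hij
    · exact absurd rfl hij
    · exact this.symm
    · exact this
    · exact absurd rfl hij
  · rw [eq_univ_iff_forall]
    intro x
    rw [mem_iUnion, Bool.exists_bool]
    rcases eq_root_or_exists_incl x with rfl | ⟨_ | k, y, rfl⟩
    · exact Or.inr ⟨_, hroot⟩
    · obtain ⟨z, rfl⟩ := hss y
      exact Or.inl ⟨z, rfl⟩
    · obtain ⟨z, rfl⟩ := hφs k y
      exact Or.inr ⟨_, hincl k z⟩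
  · intro B hB
    obtain ⟨n, hn⟩ := exists_depthEquiv_mem_iff hB
    exact hres n B hn hB

end WfTree

/-! ### Scattered spaces as tree spaces -/

section Decomposition

variable {X : Type*} [TopologicalSpace X]

/-- A clopen set can be partitioned into clopen sets around finitely many of its points. -/
lemma exists_clopen_partition [T2Space X] (hzero : IsTopologicalBasis {s : Set X | IsClopen s})
    {A P : Set X} (hA : IsClopen A) (hP : P.Finite) (hne : P.Nonempty) (hPA : P ⊆ A) :
    ∃ U : X → Set X, (∀ x ∈ P, IsClopen (U x)) ∧ (∀ x ∈ P, U x ∩ P = {x}) ∧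
      P.PairwiseDisjoint U ∧ ⋃ x ∈ P, U x = A := by
  classical
  obtain ⟨V, hV, hVd⟩ := hP.t2_separation
  have hW : ∀ x ∈ P, ∃ W : Set X, IsClopen W ∧ x ∈ W ∧ W ⊆ V x ∩ A := fun x hx =>
    hzero.exists_subset_of_mem_open (show x ∈ V x ∩ A from ⟨(hV x).1, hPA hx⟩)
      ((hV x).2.inter hA.isOpen)
  choose! W hWc hxW hWs using hW
  have hWd : ∀ x ∈ P, ∀ y ∈ P, x ≠ y → Disjoint (W x) (W y) := fun x hx y hy hxy =>
    (hVd hx hy hxy).mono (fun z hz => (hWs x hx hz).1) fun z hz => (hWs y hy hz).1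
  obtain ⟨x₀, hx₀⟩ := hne
  -- The set around `x₀` takes everything that is not near the other points.
  let R : Set X := ⋃ y ∈ P \ {x₀}, W y
  have hRc : IsClopen R := (hP.subset sdiff_subset).isClopen_biUnion fun y hy => hWc y hy.1
  let U : X → Set X := fun x => if x = x₀ then A \ R else W x
  have hU₀ : U x₀ = A \ R := if_pos rfl
  have hU : ∀ x, x ≠ x₀ → U x = W x := fun x hx => if_neg hx
  have hxU : ∀ x ∈ P, x ∈ U x := by
    intro x hx
    by_cases h : x = x₀
    · subst h
      rw [hU₀]
      refine ⟨hPA hx, fun hR => ?_⟩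
      obtain ⟨y, hy, hxy⟩ := mem_iUnion₂.1 hR
      exact (hWd y hy.1 x hx hy.2).notMem_of_mem_left hxy (hxW x hx)
    · rw [hU x h]
      exact hxW x hx
  have hd : P.PairwiseDisjoint U := by
    intro x hx y hy hxy
    have key : ∀ y ∈ P, y ≠ x₀ → Disjoint (A \ R) (W y) := fun y hy h =>
      disjoint_sdiff_left.mono_right
        (subset_biUnion_of_mem (u := W) (show y ∈ P \ {x₀} from ⟨hy, h⟩))
    show Disjoint (U x) (U y)
    by_cases h : x = x₀
    · subst h
      rw [hU₀, hU y hxy.symm]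
      exact key y hy hxy.symm
    · by_cases h' : y = x₀
      · subst h'
        rw [hU₀, hU x h]
        exact (key x hx h).symm
      · rw [hU x h, hU y h']
        exact hWd x hx y hy hxy
  refine ⟨U, fun x hx => ?_, fun x hx => ?_, hd, ?_⟩
  · by_cases h : x = x₀
    · subst h
      rw [hU₀]
      exact hA.diff hRc
    · rw [hU x h]
      exact hWc x hx
  · refine Subset.antisymm (fun y ⟨hyU, hyP⟩ => ?_) (by simp [hxU x hx, hx])
    by_contra hne
    exact (hd hyP hx hne).notMem_of_mem_left (hxU y hyP) hyU
  · refine Subset.antisymm (iUnion₂_subset fun x hx => ?_) fun y hy => ?_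
    · by_cases h : x = x₀
      · subst h
        rw [hU₀]
        exact sdiff_subset
      · rw [hU x h]
        exact fun z hz => (hWs x hx hz).2
    · by_cases hyR : y ∈ R
      · obtain ⟨x, hx, hyx⟩ := mem_iUnion₂.1 hyR
        exact mem_biUnion hx.1 (by rw [hU x hx.2]; exact hyx)
      · exact mem_biUnion hx₀ (by rw [hU₀]; exact ⟨hy, hyR⟩)

/-- Around an accumulation point `d` of `S`, a clopen set minus `d` splits into a sequence of clopen
sets that all meet `S`. -/
lemma exists_clopen_sequence [MetrizableSpace X]
    (hzero : IsTopologicalBasis {s : Set X | IsClopen s}) {A S : Set X} (hA : IsClopen A) {d : X}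
    (hd : d ∈ A) (hS : AccPt d (Filter.principal S)) :
    ∃ Z : ℕ → Set X, (∀ k, IsClopen (Z k)) ∧ (Pairwise fun i j => Disjoint (Z i) (Z j)) ∧
      ⋃ k, Z k = A \ {d} ∧ ∀ k, (Z k ∩ S).Nonempty := by
  let _ := metrizableSpaceMetric X
  let N := {V : Set X // IsClopen V ∧ d ∈ V}
  have hstep : ∀ (n : ℕ) (V : N), ∃ V' : N, V'.1 ⊆ V.1 ∧ V'.1 ⊆ Metric.ball d (1 / (n + 1)) ∧
      ((V.1 \ V'.1) ∩ S).Nonempty := by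
    rintro n ⟨V, hV, hdV⟩
    obtain ⟨y, ⟨hyV, hyS⟩, hyd⟩ := accPt_iff_nhds.1 hS V (hV.isOpen.mem_nhds hdV)
    obtain ⟨V', hV', hdV', hs⟩ := hzero.exists_subset_of_mem_open
      (show d ∈ V ∩ Metric.ball d (1 / (n + 1)) ∩ {y}ᶜ from
        ⟨⟨hdV, Metric.mem_ball_self (by positivity)⟩, hyd.symm⟩)
      ((hV.isOpen.inter Metric.isOpen_ball).inter isOpen_compl_singleton)
    exact ⟨⟨V', hV', hdV'⟩, fun z hz => (hs hz).1.1, fun z hz => (hs hz).1.2,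
      y, ⟨hyV, fun hy => (hs hy).2 rfl⟩, hyS⟩
  choose next hsub hball hmeet using hstep
  let V : ℕ → N := fun n => Nat.rec ⟨A, hA, hd⟩ next n
  have hV : ∀ n, V (n + 1) = next n (V n) := fun _ => rfl
  have hanti : Antitone fun n => (V n).1 := antitone_nat_of_succ_le fun n => hsub n (V n)
  refine ⟨fun n => (V n).1 \ (V (n + 1)).1, fun n => (V n).2.1.diff (V (n + 1)).2.1, ?_, ?_,
    fun n => hmeet n (V n)⟩
  · have key : ∀ i j, i < j → Disjoint ((V i).1 \ (V (i + 1)).1) ((V j).1 \ (V (j + 1)).1) :=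
      fun i j hij => disjoint_sdiff_left.mono_right (sdiff_subset.trans (hanti hij))
    intro i j hij
    rcases lt_or_gt_of_ne hij with h | h
    · exact key i j h
    · exact (key j i h).symm
  · refine Subset.antisymm (iUnion_subset fun n x hx => ⟨hanti (Nat.zero_le n) hx.1, ?_⟩) ?_
    · rintro rfl
      exact hx.2 (V (n + 1)).2.2
    · rintro x ⟨hxA, hxd⟩
      have hex : ∃ n, x ∉ (V n).1 := by
        obtain ⟨n, hn⟩ := exists_nat_one_div_lt (dist_pos.2 hxd)
        exact ⟨n + 1, fun h => lt_asymm hn (hball n (V n) h)⟩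
      classical
      obtain ⟨m, hm⟩ : ∃ m, Nat.find hex = m + 1 :=
        Nat.exists_eq_succ_of_ne_zero fun h0 => Nat.find_spec hex (h0 ▸ hxA)
      refine mem_iUnion.2 ⟨m, not_not.1 (Nat.find_min hex (by omega)), ?_⟩
      rw [← hm]
      exact Nat.find_spec hex

/-- A clopen set is partitioned, off one of its points `d` of height above `a`, into countably many
clopen sets of height at least `a` with exactly one point of maximal height. -/
lemma IsScatteredSpace.exists_partition [CompactSpace X] [MetrizableSpace X]
    (hX : IsScatteredSpace X) (hzero : IsTopologicalBasis {s : Set X | IsClopen s})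
    {A : Set X} (hA : IsClopen A) {d : X} (hd : d ∈ A) {a : Ordinal}
    (hda : d ∈ (univ : Set X)ᵈ[a + 1]) :
    ∃ (ι : Type) (_ : Countable ι) (B : ι → Set X) (b : ι → Ordinal) (x : ι → X),
      (∀ i, IsClopen (B i)) ∧ (Pairwise fun i j => Disjoint (B i) (B j)) ∧
      ⋃ i, B i = A \ {d} ∧ (∀ i, B i ∩ (univ : Set X)ᵈ[b i] = {x i}) ∧ ∀ i, a ≤ b i := by
  obtain ⟨Z, hZ, hZd, hZu, hZS⟩ := exists_clopen_sequence hzero hA hd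
    (mem_iteratedDerivedSet_succ.1 hda).1
  choose b hbne hbfin hbemp using fun k =>
    hX.exists_finite_top (hZ k).isClosed.isCompact (hZS k).left
  have hab : ∀ k, a ≤ b k := by
    intro k
    by_contra! h
    obtain ⟨y, hyZ, hy⟩ := hZS k
    exact (hbemp k ▸ ⟨hyZ, iteratedDerivedSet_antitone _ (Order.add_one_le_of_lt h) hy⟩ :
      y ∈ (∅ : Set X))
  choose U hU hUP hUd hUu using fun k =>
    exists_clopen_partition hzero (hZ k) (hbfin k) (hbne k) inter_subset_left
  have hsub : ∀ k, ∀ x ∈ Z k ∩ (univ : Set X)ᵈ[b k], U k x ⊆ Z k := fun k x hx => by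
    conv_rhs => rw [← hUu k]
    exact subset_biUnion_of_mem (u := U k) hx
  let κ := Σ k, ↥(Z k ∩ (univ : Set X)ᵈ[b k])
  have : ∀ k, Countable ↥(Z k ∩ (univ : Set X)ᵈ[b k]) := fun k => (hbfin k).countable.to_subtype
  let e : κ ≃ Shrink.{0} κ := equivShrink κ
  refine ⟨Shrink.{0} κ, e.symm.injective.countable, fun i => U (e.symm i).1 (e.symm i).2,
    fun i => b (e.symm i).1, fun i => (e.symm i).2, fun i => hU _ _ (e.symm i).2.2, ?_, ?_,
    fun i => ?_, fun i => hab _⟩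
  · have key : Pairwise fun s s' : κ => Disjoint (U s.1 s.2) (U s'.1 s'.2) := by
      rintro ⟨k, x, hx⟩ ⟨l, y, hy⟩ hne
      by_cases hkl : k = l
      · subst hkl
        exact hUd k hx hy fun h => hne (by subst h; rfl)
      · exact (hZd hkl).mono (hsub k x hx) (hsub l y hy)
    exact key.comp_of_injective e.symm.injective
  · rw [e.symm.surjective.iUnion_comp fun s : κ => U s.1 s.2, iUnion_sigma, ← hZu]
    refine iUnion_congr fun k => ?_
    exact (biUnion_eq_iUnion _ fun x _ => U k x).symm.trans (hUu k)
  · have := hUP _ _ (e.symm i).2.2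
    rwa [← inter_assoc, inter_eq_self_of_subset_left (hsub _ _ (e.symm i).2.2)] at this

/-- The pieces of a partition as in `IsScatteredSpace.exists_partition` reach every height below
that of `d` infinitely often. -/
lemma infinite_setOf_le_height {A : Set X} (hA : IsClopen A) {d : X} (hd : d ∈ A) {a : Ordinal}
    (hda : d ∈ (univ : Set X)ᵈ[a + 1]) {ι : Type*} {B : ι → Set X} {b : ι → Ordinal} {x : ι → X}
    (hB : ∀ i, IsClopen (B i)) (hBu : ⋃ i, B i = A \ {d})
    (hBx : ∀ i, B i ∩ (univ : Set X)ᵈ[b i] = {x i}) : {i | a ≤ b i}.Infinite := by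
  intro hfin
  have hdB : ∀ i, d ∉ B i := fun i hi =>
    ((hBu ▸ mem_iUnion.2 ⟨i, hi⟩ : d ∈ A \ {d})).2 rfl
  have hopen : IsOpen (A \ ⋃ i ∈ {i | a ≤ b i}, B i) :=
    (hA.diff (hfin.isClopen_biUnion fun i _ => hB i)).isOpen
  obtain ⟨y, ⟨⟨hyA, hyB⟩, hya⟩, hyd⟩ := accPt_iff_nhds.1 (mem_iteratedDerivedSet_succ.1 hda).1 _
    (hopen.mem_nhds ⟨hd, by simp [hdB]⟩)
  have hyu : y ∈ ⋃ i, B i := by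
    rw [hBu]
    exact ⟨hyA, hyd⟩
  obtain ⟨i, hi⟩ := mem_iUnion.1 hyu
  have hlt : b i < a := by
    by_contra! h
    exact hyB (mem_biUnion (x := i) h hi)
  have hyi := iteratedDerivedSet_antitone _ (Order.add_one_le_of_lt hlt) hya
  obtain ⟨hacc, hy⟩ := mem_iteratedDerivedSet_succ.1 hyi
  obtain ⟨z, hz, hzy⟩ := accPt_iff_nhds.1 hacc _ ((hB i).isOpen.mem_nhds hi)
  have hsub : (B i ∩ (univ : Set X)ᵈ[b i]).Subsingleton := by
    rw [hBx i]
    exact subsingleton_singleton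
  exact hzy (hsub hz ⟨hi, hy⟩)

/-- Assembly of a tree space from the spaces of the children. -/
lemma WfTree.nonempty_homeomorph_mk [CompactSpace X] [T2Space X] {A : Set X} (hA : IsClopen A)
    {d : X} (hd : d ∈ A) {ι : Type} {B : ι → Set X} (hB : ∀ i, IsClopen (B i))
    (hBd : Pairwise fun i j => Disjoint (B i) (B j)) (hBu : ⋃ i, B i = A \ {d})
    {c : ι → WfTree} (h : ∀ i, (c i).Space ≃ₜ B i) : Nonempty ((WfTree.mk ι c).Space ≃ₜ A) := by
  have hBA : ∀ i, B i ⊆ A \ {d} := fun i => hBu ▸ subset_iUnion B i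
  let f : (Σ i, (c i).Space) → A := fun s => ⟨h s.1 s.2, (hBA s.1 (h s.1 s.2).2).1⟩
  have hfc : Continuous f := continuous_sigma fun i =>
    (continuous_subtype_val.comp (h i).continuous).subtype_mk _
  have hfi : Function.Injective f := by
    rintro ⟨i, x⟩ ⟨j, y⟩ hxy
    have hxy' : ((h i x : B i) : X) = h j y := congrArg Subtype.val hxy
    by_cases hij : i = j
    · subst hij
      rw [(h i).injective (Subtype.ext hxy')]
    · exact absurd (hxy' ▸ (h j y).2) ((hBd hij).notMem_of_mem_left (h i x).2)
  have hfo : IsOpenMap f := by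
    rw [isOpenMap_sigma]
    intro i U hU
    have : (fun x => f ⟨i, x⟩) '' U = Subtype.val ⁻¹' (Subtype.val '' (h i '' U)) := by
      ext ⟨y, hy⟩
      simp only [mem_image, mem_preimage, exists_exists_and_eq_and, f, Subtype.mk.injEq]
    rw [this]
    exact ((hB i).isOpen.isOpenMap_subtype_val _ ((h i).isOpenMap _ hU)).preimage
      continuous_subtype_val
  have hr : range f = {⟨d, hd⟩}ᶜ := by
    ext ⟨y, hy⟩
    rw [mem_compl_singleton_iff, ne_eq, Subtype.mk.injEq]
    constructor
    · rintro ⟨⟨i, x⟩, hx⟩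
      have hy' : ((h i x : B i) : X) = y := congrArg Subtype.val hx
      rw [← hy']
      exact (hBA i (h i x).2).2
    · intro hyd
      have hyu : y ∈ ⋃ i, B i := by
        rw [hBu]
        exact ⟨hy, hyd⟩
      obtain ⟨i, hi⟩ := mem_iUnion.1 hyu
      exact ⟨⟨i, (h i).symm ⟨y, hi⟩⟩, Subtype.ext (by simp [f])⟩
  have : CompactSpace A := isCompact_iff_compactSpace.1 hA.isClosed.isCompact
  exact ⟨OnePoint.equivOfIsEmbeddingOfRangeEq ⟨d, hd⟩ f
    (IsOpenEmbedding.of_continuous_injective_isOpenMap hfc hfi hfo).isEmbedding hr⟩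

/-- A clopen set with exactly one point of maximal height `a` is a tree space of rank `a`. -/
lemma IsScatteredSpace.exists_homeomorph_space [CompactSpace X] [MetrizableSpace X]
    (hX : IsScatteredSpace X) (hzero : IsTopologicalBasis {s : Set X | IsClopen s})
    {A : Set X} (hA : IsClopen A) {d : X} {a : Ordinal} (hAd : A ∩ (univ : Set X)ᵈ[a] = {d}) :
    ∃ t : WfTree, t.HasRank a ∧ Nonempty (t.Space ≃ₜ A) := by
  induction a using WellFoundedLT.induction generalizing A d with
  | ind a ih =>
    obtain ⟨hdA, hda⟩ : d ∈ A ∩ (univ : Set X)ᵈ[a] := hAd ▸ mem_singleton d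
    rcases eq_or_ne a 0 with rfl | ha
    · rw [iteratedDerivedSet_zero, inter_univ] at hAd
      refine ⟨.mk Empty Empty.elim, ⟨inferInstance, fun _ => 0, by simp, by simp, by simp⟩, ?_⟩
      exact WfTree.nonempty_homeomorph_mk hA hdA (B := Empty.elim) (by simp) (fun i => i.elim)
        (by simp [hAd]) fun i => i.elim
    · have hd1 : d ∈ (univ : Set X)ᵈ[0 + 1] :=
        iteratedDerivedSet_antitone _
          (by simpa [Order.one_le_iff_pos] using pos_iff_ne_zero.2 ha) hda
      obtain ⟨ι, hι, B, b, x, hB, hBd, hBu, hBx, -⟩ := hX.exists_partition hzero hA hdA hd1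
      have hlt : ∀ i, b i < a := by
        intro i
        by_contra! h
        obtain ⟨hxB, hxb⟩ : x i ∈ B i ∩ (univ : Set X)ᵈ[b i] := hBx i ▸ mem_singleton _
        obtain ⟨hxA, hxd⟩ : x i ∈ A \ {d} := hBu ▸ mem_iUnion.2 ⟨i, hxB⟩
        exact hxd (hAd ▸ ⟨hxA, iteratedDerivedSet_antitone _ h hxb⟩)
      choose c hc h using fun i => ih (b i) (hlt i) (hB i) (hBx i)
      refine ⟨.mk ι c, ⟨hι, b, hlt, hc, fun γ hγ => ?_⟩,
        WfTree.nonempty_homeomorph_mk hA hdA hB hBd hBu fun i => (h i).some⟩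
      exact infinite_setOf_le_height hA hdA
        (iteratedDerivedSet_antitone _ (Order.add_one_le_of_lt hγ) hda) hB hBu hBx

/-- A clopen set with exactly one point of maximal height `a + 1` is the space of a tree whose
root has a sequence of children, all of rank `a`. -/
lemma IsScatteredSpace.exists_homeomorph_space_nat [CompactSpace X] [MetrizableSpace X]
    (hX : IsScatteredSpace X) (hzero : IsTopologicalBasis {s : Set X | IsClopen s})
    {A : Set X} (hA : IsClopen A) {d : X} {a : Ordinal}
    (hAd : A ∩ (univ : Set X)ᵈ[a + 1] = {d}) :
    ∃ c : ℕ → WfTree, (∀ k, (c k).HasRank a) ∧ Nonempty ((WfTree.mk ℕ c).Space ≃ₜ A) := by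
  obtain ⟨hdA, hda⟩ : d ∈ A ∩ (univ : Set X)ᵈ[a + 1] := hAd ▸ mem_singleton d
  obtain ⟨ι, hι, B, b, x, hB, hBd, hBu, hBx, hab⟩ := hX.exists_partition hzero hA hdA hda
  have hba : ∀ i, b i = a := by
    intro i
    refine le_antisymm ?_ (hab i)
    by_contra! h
    obtain ⟨hxB, hxb⟩ : x i ∈ B i ∩ (univ : Set X)ᵈ[b i] := hBx i ▸ mem_singleton _
    obtain ⟨hxA, hxd⟩ : x i ∈ A \ {d} := hBu ▸ mem_iUnion.2 ⟨i, hxB⟩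
    exact hxd (hAd ▸ ⟨hxA, iteratedDerivedSet_antitone _ (Order.add_one_le_of_lt h) hxb⟩)
  have : Infinite ι := by
    rw [← infinite_univ_iff]
    exact (infinite_setOf_le_height hA hdA hda hB hBu hBx).mono (subset_univ _)
  obtain ⟨_⟩ := nonempty_denumerable ι
  let e : ℕ ≃ ι := (Denumerable.eqv ι).symm
  choose c hc h using fun k => hX.exists_homeomorph_space hzero (hB (e k)) (hBx (e k))
  refine ⟨c, fun k => hba (e k) ▸ hc k, WfTree.nonempty_homeomorph_mk hA hdA
    (fun k => hB (e k)) (hBd.comp_of_injective e.injective) ?_ fun k => (h k).some⟩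
  rw [e.surjective.iUnion_comp B, hBu]

/-- A copy of `M` that is clopen in `X` is a retract of `X`. -/
lemma Homeomorph.exists_retraction {M : Type*} [TopologicalSpace M] {A : Set X} (hA : IsClopen A)
    (h : M ≃ₜ A) (m : M) :
    ∃ g : X → M, Continuous g ∧ (∀ y, g (h y) = y) ∧ ∀ x ∉ A, g x = m := by
  classical
  let r : X → A := fun x => if hx : x ∈ A then ⟨x, hx⟩ else h m
  have hr : Continuous r := by
    rw [continuous_iff_continuousAt]
    intro x
    by_cases hx : x ∈ A
    · rw [Topology.IsInducing.subtypeVal.continuousAt_iff]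
      refine continuousAt_id.congr ?_
      filter_upwards [hA.isOpen.mem_nhds hx] with y hy
      simp [r, hy]
    · refine (continuousAt_const (y := h m)).congr ?_
      filter_upwards [hA.compl.isOpen.mem_nhds hx] with y hy
      simp only [r]
      rw [dif_neg hy]
  refine ⟨fun x => h.symm (r x), h.symm.continuous.comp hr, fun y => ?_, fun x hx => ?_⟩
  · simp [r]
  · simp [r, hx]

/-- A compact scattered space whose last nonempty derivative is finite and has successor order
has a resolving system. -/
lemma IsScatteredSpace.hasResolvingSystem_of_succ [CompactSpace X] [MetrizableSpace X]
    (hX : IsScatteredSpace X) (hzero : IsTopologicalBasis {s : Set X | IsClopen s})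
    {a : Ordinal} (hne : ((univ : Set X)ᵈ[a + 1]).Nonempty)
    (hfin : ((univ : Set X)ᵈ[a + 1]).Finite) : HasResolvingSystem X := by
  obtain ⟨U, hU, hUP, hUd, hUu⟩ := exists_clopen_partition hzero isClopen_univ hfin hne
    (subset_univ _)
  have := hfin.to_subtype
  obtain ⟨n, ⟨e⟩⟩ := Finite.exists_equiv_fin ↥((univ : Set X)ᵈ[a + 1])
  let P : Fin n → Set X := fun j => U (e.symm j)
  have hP : ∀ j, IsClopen (P j) := fun j => hU _ (e.symm j).2
  have hPd : Pairwise fun i j => Disjoint (P i) (P j) := fun i j hij =>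
    hUd (e.symm i).2 (e.symm j).2 fun h => hij (e.symm.injective (Subtype.ext h))
  have hPu : ⋃ j, P j = univ := by
    rw [← hUu, biUnion_eq_iUnion]
    exact e.symm.surjective.iUnion_comp fun s : ↥((univ : Set X)ᵈ[a + 1]) => U s
  choose c hc hh using fun j : Fin n => hX.exists_homeomorph_space_nat hzero (hP j)
    (hUP _ (e.symm j).2)
  have h := fun j => (hh j).some
  obtain ⟨d₀, hd₀⟩ := hne
  let j₀ : Fin n := e ⟨d₀, hd₀⟩
  have hrank : ∀ j, (WfTree.mk ℕ (c j)).HasRank (a + 1) := fun j => WfTree.hasRank_mk_nat (hc j)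
  have hu : ∀ j, ∃ u : (WfTree.mk ℕ (c j₀)).Space → X, Continuous u ∧ range u = P j ∧
      (j = j₀ → ∀ y, u y = h j₀ y) := by
    intro j
    by_cases hj : j = j₀
    · subst hj
      refine ⟨fun y => h j₀ y, continuous_subtype_val.comp (h j₀).continuous, ?_, fun _ _ => rfl⟩
      exact ((h j₀).surjective.range_comp Subtype.val).trans Subtype.range_coe
    · obtain ⟨φ, hφ, hφs⟩ := WfTree.exists_surjective_preservesDepth (hrank j) (hrank j₀) le_rfl
      refine ⟨fun y => h j (φ y), continuous_subtype_val.comp ((h j).continuous.comp hφ.1), ?_,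
        fun h => absurd h hj⟩
      exact (((h j).surjective.comp hφs).range_comp Subtype.val).trans Subtype.range_coe
  choose u huc hur hu₀ using hu
  obtain ⟨g, hg, hgh, hgc⟩ := (h j₀).exists_retraction (hP j₀) (WfTree.root (c j₀))
  refine (WfTree.hasResolvingSystem_of_hasRank (hc j₀)).of_pieces u huc (fun i j hij => ?_) ?_ g hg
    j₀ (fun y => by rw [hu₀ j₀ rfl, hgh]) fun j hj => ⟨WfTree.root (c j₀), fun y => hgc _ ?_⟩
  · show Disjoint (range (u i)) (range (u j))
    rw [hur, hur]
    exact hPd hij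
  · simp only [hur, hPu]
  · exact (hPd hj).notMem_of_mem_left (hur j ▸ mem_range_self y)

end Decomposition

/-- On a finite discrete space the constant maps form a resolving system. -/
lemma hasResolvingSystem_of_finite {X : Type*} [TopologicalSpace X] [Finite X] :
    HasResolvingSystem X := by
  obtain ⟨n, ⟨e⟩⟩ := Finite.exists_equiv_fin X
  refine ⟨Fin n, inferInstance, fun i _ => e.symm i, fun i => continuous_const, ?_, ?_, ?_⟩
  · intro i j hij
    rw [Set.disjoint_left]
    rintro _ ⟨x, rfl⟩ ⟨y, h⟩
    exact hij (e.symm.injective h.symm)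
  · exact eq_univ_iff_forall.2 fun x => mem_iUnion.2 ⟨e x, x, by simp⟩
  · intro B _
    refine Resolved.of_preimage fun i => ⟨0, ?_⟩
    by_cases h : e.symm i ∈ B
    · exact Or.inr (by simp [h])
    · exact Or.inl (by simp [h])

lemma IsScatteredSpace.hasResolvingSystem {X : Type*} [TopologicalSpace X] [CompactSpace X]
    [MetrizableSpace X] (hX : IsScatteredSpace X)
    (hzero : IsTopologicalBasis {s : Set X | IsClopen s})
    (h : IsZeroOrSuccessorOrdinal (scatteredHeight X)) : HasResolvingSystem X := by
  rcases isEmpty_or_nonempty X with hemp | hne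
  · exact hasResolvingSystem_of_finite
  obtain ⟨a, ha, hane, hafin, -⟩ := hX.exists_scatteredHeight_eq
  obtain ⟨a', ha', h⟩ := h
  obtain rfl : a = a' := WithTop.coe_eq_coe.1 (ha.symm.trans ha')
  rcases h with rfl | ⟨b, rfl⟩
  · rw [iteratedDerivedSet_zero] at hafin
    have := finite_univ_iff.1 hafin
    exact hasResolvingSystem_of_finite
  · exact hX.hasResolvingSystem_of_succ hzero hane hafin

theorem theorem1 {X : Type*} [TopologicalSpace X] [CompactSpace X] [MetrizableSpace X]
    (hzero : IsTopologicalBasis {s : Set X | IsClopen s}) :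
    List.TFAE [
      IsTopologicalFractal X,
      IsBanachFractal X,
      IsBanachUltrafractal X,
      ¬ IsCountableLimitOrdinal (scatteredHeight X),
      scatteredHeight X = ⊤ ∨
        (IsCountableOrdinal (scatteredHeight X) ∧ IsZeroOrSuccessorOrdinal (scatteredHeight X)),
      Uncountable X ∨ (Countable X ∧ IsZeroOrSuccessorOrdinal (scatteredHeight X))] := by
  tfae_have 1 → 4 := fun h => h.not_isCountableLimitOrdinal
  tfae_have 4 → 5 := by
    intro h
    by_cases hX : IsScatteredSpace X
    · right
      rcases isEmpty_or_nonempty X with hemp | hne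
      · rw [scatteredHeight_of_isEmpty]
        exact ⟨⟨0, rfl, by simp⟩, ⟨0, rfl, Or.inl rfl⟩⟩
      have : Countable X := hX.countable
      obtain ⟨a, ha, hane, -, -⟩ := hX.exists_scatteredHeight_eq
      have hac := hX.card_le_aleph0 hane
      refine ⟨⟨a, ha, hac⟩, a, ha, ?_⟩
      rcases Ordinal.zero_or_succ_or_isSuccLimit a with h0 | ⟨b, hb⟩ | hlim
      · exact Or.inl h0
      · exact Or.inr ⟨b, hb.symm⟩
      · exact absurd ⟨a, ha, hac, hlim⟩ h
    · exact Or.inl (if_neg hX)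
  tfae_have 5 → 6 := by
    intro h
    rcases h with h | ⟨-, h⟩
    · left
      refine uncountable_of_not_isScatteredSpace fun hX => ?_
      rw [scatteredHeight, if_pos hX] at h
      exact WithTop.coe_ne_top h
    · by_cases hc : Countable X
      · exact Or.inr ⟨hc, h⟩
      · exact Or.inl (not_countable_iff.1 hc)
  tfae_have 6 → 3 := by
    intro h
    refine HasResolvingSystem.isBanachUltrafractal hzero ?_
    by_cases hX : IsScatteredSpace X
    · rcases h with h | ⟨-, h⟩
      · exact absurd hX.countable (not_countable_iff.2 h)
      · exact hX.hasResolvingSystem hzero h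
    · obtain ⟨K, hK, hne⟩ := exists_perfect_of_not_isScatteredSpace hX
      exact hasResolvingSystem_of_perfect hzero hK hne
  tfae_have 3 → 2 := fun h => h.isBanachFractal
  tfae_have 2 → 1 := fun h => h.isTopologicalFractal
  tfae_finish
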